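/- Let $\mathsf C$ be a symmetric monoidal category with unit object $K$ and symmetry $c$ (associativity and unit constraints are suppressed in formulas, and an object also denotes its identity morphism). Let $H=(H,\eta_H,\mu_H,\varepsilon_H,\delta_H,\lambda_H)$ be a Hopf algebra in $\mathsf C$ which is cocommutative, $c_{H,H}\circ\delta_H=\delta_H$, and finite, i.e. there are an object $H^*$ and morphisms $a\colon K\to H^*\otimes H$, $b\colon H\otimes H^*\to K$ with $(b\otimes H)\circ(H\otimes a)=\mathrm{id}_H$ and $(H^*\otimes b)\circ(a\otimes H^*)=\mathrm{id}_{H^*}$. (The antipode $\lambda_H$ is then an isomorphism.) For algebras $A,B$ put $\mu_{A\otimes B}=(\mu_A\otimes\mu_B)\circ(A\otimes c_{B,A}\otimes B)$, and for coalgebras $\delta_{A\otimes B}=(A\otimes c_{A,B}\otimes B)\circ(\delta_A\otimes\delta_B)$. Let $\widehat H=(H^{\mathrm{cop}})^*$ be the object $H^*$ with $$\eta_{\widehat H}=(H^*\otimes\varepsilon_H)\circ a,\qquad \varepsilon_{\widehat H}=b\circ(\eta_H\otimes H^*),\qquad \lambda_{\widehat H}=(H^*\otimes b)\circ(H^*\otimes\lambda_H^{-1}\otimes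 H^*)\circ(a\otimes H^*),$$ $$\mu_{\widehat H}=(H^*\otimes b)\circ(H^*\otimes H\otimes b\otimes H^*)\circ\bigl(((H^*\otimes (c_{H,H}\circ\delta_H))\circ a)\otimes H^*\otimes H^*\bigr),$$ $$\delta_{\widehat H}=\bigl(H^*\otimes H^*\otimes (b\circ(\mu_H\otimes H^*))\bigr)\circ\bigl(((H^*\otimes a\otimes H)\circ a)\otimes H^*\bigr).$$ Let $T=T(H)=\widehat H\otimes H$ be the tensor product Hopf algebra, with $\lambda_T=\lambda_{\widehat H}\otimes\lambda_H$, and let $$\omega=\varepsilon_{\widehat H}\otimes b\otimes\varepsilon_H,\qquad \omega^{-1}=\varepsilon_{\widehat H}\otimes(b\circ(\lambda_H^{-1}\otimes H^*))\otimes\varepsilon_H\colon\ T\otimes T\to K .$$ The Drinfeld double $D(H)=T^{\omega}$ is the deformation of $T$ by the two-cocycle $\omega$: it has the same object, unit, counit and coproduct as $T$, and product and antipode $$\mu_{D(H)}=(\omega\otimes\mu_T\otimes\omega^{-1})\circ(T\otimes T\otimes\delta_{T\otimes T})\circ\delta_{T\otimes T},\qquad \lambda_{D(H)}=\bigl(f\otimes((\lambda_T\otimes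 f')\circ\delta_T)\bigr)\circ\delta_T,$$ where $f=\omega\circ(T\otimes\lambda_T)\circ\delta_T$ and $f'=\omega^{-1}\circ(\lambda_T\otimes T)\circ\delta_T$. Then $(T(H),D(H))$ is a Hopf brace in $\mathsf C$. That is, $T(H)$ and $D(H)$ are Hopf algebras in $\mathsf C$ with the same underlying coalgebra $(T,\varepsilon_T,\delta_T)$, and $$\mu_{D(H)}\circ(T\otimes\mu_{T})=\mu_{T}\circ(\mu_{D(H)}\otimes\Gamma)\circ(T\otimes c_{T,T}\otimes T)\circ(\delta_T\otimes T\otimes T),\qquad \Gamma=\mu_T\circ(\lambda_T\otimes\mu_{D(H)})\circ(\delta_T\otimes T).$$ -/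

import Mathlib

open CategoryTheory MonoidalCategory

universe v u

namespace HopfBraces

open scoped MonObj ComonObj HopfObj

noncomputable section

variable {C : Type u} [Category.{v} C] [MonoidalCategory C]

/-- The structure morphisms of a Hopf algebra on the object `X` (unit, product, counit, coproduct,
antipode), without axioms. The axioms are the predicate `HopfData.IsHopf`. -/
@[ext]
structure HopfData (X : C) where
  /-- the unit -/
  one : 𝟙_ C ⟶ X
  /-- the product -/
  mul : X ⊗ X ⟶ X
  /-- the counit -/
  counit : X ⟶ 𝟙_ C
  /-- the coproduct -/
  comul : X ⟶ X ⊗ X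
  /-- the antipode -/
  antipode : X ⟶ X

namespace HopfData

/-- The dual of the structure morphisms on `X`, on an object `Y = X^*` with `X ⊗ - ⊣ Y ⊗ -`.
Here `η_ Y X : 𝟙 ⟶ Y ⊗ X` is the unit `a` and `ε_ Y X : X ⊗ Y ⟶ 𝟙` the counit `b` of the duality.
On elements, for the nested pairing: `(f g)(x) = f(x₂) g(x₁)` and `f₁(x) f₂(y) = f(y x)`. -/
def dual {X : C} (A : HopfData X) (Y : C) [ExactPairing Y X] : HopfData Y where
  one := η_ Y X ≫ Y ◁ A.counit ≫ (ρ_ Y).hom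
  mul := 𝟙 (Y ⊗ Y) ⊗≫ η_ Y X ▷ (Y ⊗ Y) ⊗≫ Y ◁ A.comul ▷ (Y ⊗ Y) ⊗≫
    Y ◁ X ◁ ε_ Y X ▷ Y ⊗≫ Y ◁ ε_ Y X ⊗≫ 𝟙 Y
  counit := (λ_ Y).inv ≫ A.one ▷ Y ≫ ε_ Y X
  comul := 𝟙 Y ⊗≫ η_ Y X ▷ Y ⊗≫ Y ◁ η_ Y X ▷ (X ⊗ Y) ⊗≫ Y ◁ Y ◁ A.mul ▷ Y ⊗≫
    Y ◁ Y ◁ ε_ Y X ⊗≫ 𝟙 (Y ⊗ Y)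
  antipode := 𝟙 Y ⊗≫ η_ Y X ▷ Y ⊗≫ Y ◁ A.antipode ▷ Y ⊗≫ Y ◁ ε_ Y X ⊗≫ 𝟙 Y

variable [BraidedCategory C]

/-- The structure morphisms underlying a Hopf algebra. -/
def ofHopfObj (X : C) [HopfObj X] : HopfData X where
  one := η[X]
  mul := μ[X]
  counit := ε[X]
  comul := Δ[X]
  antipode := 𝒮[X]

/-- The morphisms in `A` satisfy the axioms of a Hopf algebra. -/
def IsHopf {X : C} (A : HopfData X) : Prop :=
  ∃ h : HopfObj X, @ofHopfObj C _ _ _ X h = A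

/-- The co-opposite `A^cop`: the coproduct is composed with the symmetry and the antipode is
inverted. -/
def cop {X : C} (A : HopfData X) [IsIso A.antipode] : HopfData X where
  one := A.one
  mul := A.mul
  counit := A.counit
  comul := A.comul ≫ (β_ X X).hom
  antipode := inv A.antipode

/-- The coproduct of the tensor product coalgebra `X ⊗ Y`. -/
def tensorComul {X Y : C} (A : HopfData X) (B : HopfData Y) :
    X ⊗ Y ⟶ (X ⊗ Y) ⊗ (X ⊗ Y) :=
  (A.comul ⊗ₘ B.comul) ≫ tensorμ X X Y Y

/-- The tensor product of Hopf algebras. -/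
def tensor {X Y : C} (A : HopfData X) (B : HopfData Y) : HopfData (X ⊗ Y) where
  one := (λ_ (𝟙_ C)).inv ≫ (A.one ⊗ₘ B.one)
  mul := tensorμ X Y X Y ≫ (A.mul ⊗ₘ B.mul)
  counit := (A.counit ⊗ₘ B.counit) ≫ (λ_ (𝟙_ C)).hom
  comul := tensorComul A B
  antipode := A.antipode ⊗ₘ B.antipode

/-- The deformation `A^σ` of `A` by a two-cocycle `σ : X ⊗ X ⟶ 𝟙` whose convolution inverse
is `σ'`. On elements, `a ·_σ b = σ(a₁, b₁) a₂ b₂ σ'(a₃, b₃)` and the antipode is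
`f(a₁) S(a₂) f'(a₃)` with `f(a) = σ(a₁, S(a₂))` and `f'(a) = σ'(S(a₁), a₂)`. -/
def deform {X : C} (A : HopfData X) (σ σ' : X ⊗ X ⟶ 𝟙_ C) : HopfData X where
  one := A.one
  mul := tensorComul A A ≫ (X ⊗ X) ◁ tensorComul A A ≫ (σ ⊗ₘ (A.mul ⊗ₘ σ')) ≫
    (λ_ (X ⊗ 𝟙_ C)).hom ≫ (ρ_ X).hom
  counit := A.counit
  comul := A.comul
  antipode := A.comul ≫ X ◁ A.comul ≫
    ((A.comul ≫ X ◁ A.antipode ≫ σ) ⊗ₘ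
      (A.antipode ⊗ₘ (A.comul ≫ A.antipode ▷ X ≫ σ'))) ≫
    (λ_ (X ⊗ 𝟙_ C)).hom ≫ (ρ_ X).hom

/-- The morphism `Γ = μ¹ ∘ (λ¹ ⊗ μ²) ∘ (δ ⊗ X)` of two structures on `X`. -/
def Gam {X : C} (A₁ A₂ : HopfData X) : X ⊗ X ⟶ X :=
  A₁.comul ▷ X ≫ (α_ X X X).hom ≫ (A₁.antipode ⊗ₘ A₂.mul) ≫ A₁.mul

end HopfData

variable [BraidedCategory C]

/-- The pair `(A₁, A₂)` is a Hopf brace: both are Hopf algebras, they have the same underlying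
coalgebra, and on elements `a ∘ (b · c) = (a₁ ∘ b) · Γ(a₂, c)`, where `·` is the product of `A₁`
and `∘` that of `A₂`. -/
structure IsHopfBrace {X : C} (A₁ A₂ : HopfData X) : Prop where
  isHopf₁ : A₁.IsHopf
  isHopf₂ : A₂.IsHopf
  counit_eq : A₂.counit = A₁.counit
  comul_eq : A₂.comul = A₁.comul
  compat : X ◁ A₁.mul ≫ A₂.mul =
    A₁.comul ▷ (X ⊗ X) ≫ tensorμ X X X X ≫ (A₂.mul ⊗ₘ A₁.Gam A₂) ≫ A₁.mul

section Double

variable (H Hd : C) [HopfObj H]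

/-- The antipode of a cocommutative Hopf algebra is an involution. -/
theorem antipode_antipode_of_comm [IsCommComonObj H] : 𝒮[H] ≫ 𝒮[H] = 𝟙 H := by
  have e1 : Δ[H] ≫ (𝒮[H] ≫ 𝒮[H]) ▷ H ≫ H ◁ 𝒮[H] ≫ μ[H] = ε[H] ≫ η[H] := by
    have h := HopfObj.antipode_comul H
    rw [IsCommComonObj.comul_comm_assoc] at h
    have h2 : Δ[H] ≫ (𝒮[H] ≫ 𝒮[H]) ▷ H ≫ H ◁ 𝒮[H] ≫ μ[H] =
        (Δ[H] ≫ (𝒮[H] ⊗ₘ 𝒮[H])) ≫ 𝒮[H] ▷ H ≫ μ[H] := by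
      simp [MonoidalCategory.tensorHom_def', ← whisker_exchange_assoc]
    rw [h2, ← h]
    simp
  have e2 : Δ[H] ≫ 𝒮[H] ▷ H ≫ H ◁ 𝟙 H ≫ μ[H] = ε[H] ≫ η[H] := by simp
  exact left_inv_eq_right_inv (M := Conv H H) (a := 𝒮[H]) e1 e2

instance isIso_antipode_of_comm [IsCommComonObj H] : IsIso 𝒮[H] :=
  ⟨𝒮[H], antipode_antipode_of_comm H, antipode_antipode_of_comm H⟩

instance isIso_ofHopfObj_antipode [h : IsIso 𝒮[H]] : IsIso (HopfData.ofHopfObj H).antipode := h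

variable [IsIso 𝒮[H]] [ExactPairing Hd H]

/-- The Hopf algebra `Ĥ = (H^cop)^*` on the dual object `Hd = H^*`. -/
def dualCop : HopfData Hd := (HopfData.ofHopfObj H).cop.dual Hd

/-- `T(H) = (H^cop)^* ⊗ H`, the tensor product Hopf algebra. -/
def tensorDouble : HopfData (Hd ⊗ H) := (dualCop H Hd).tensor (HopfData.ofHopfObj H)

/-- `ε ⊗ H ⊗ H^* ⊗ ε : (H^* ⊗ H) ⊗ (H^* ⊗ H) ⟶ H ⊗ H^*`, where the first `ε` is the counit of
`Ĥ` and the second that of `H`. -/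
def doubleProj : (Hd ⊗ H) ⊗ (Hd ⊗ H) ⟶ H ⊗ Hd :=
  ((dualCop H Hd).counit ▷ H ≫ (λ_ H).hom) ⊗ₘ (Hd ◁ ε[H] ≫ (ρ_ Hd).hom)

/-- The two-cocycle `ω = ε ⊗ b ⊗ ε` on `T(H)`. -/
def doubleCocycle : (Hd ⊗ H) ⊗ (Hd ⊗ H) ⟶ 𝟙_ C :=
  doubleProj H Hd ≫ ε_ Hd H

/-- The convolution inverse `ω⁻¹ = ε ⊗ (b ∘ (λ⁻¹ ⊗ H^*)) ⊗ ε` of `ω`. -/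
def doubleCocycleInv : (Hd ⊗ H) ⊗ (Hd ⊗ H) ⟶ 𝟙_ C :=
  doubleProj H Hd ≫ inv 𝒮[H] ▷ Hd ≫ ε_ Hd H

/-- The Drinfeld double `D(H)`, the deformation of `T(H)` by the two-cocycle `ω`. -/
def drinfeldDouble : HopfData (Hd ⊗ H) :=
  (tensorDouble H Hd).deform (doubleCocycle H Hd) (doubleCocycleInv H Hd)

end Double

end

end HopfBraces

/-! Write `ω(t, s) = b(snd t, fst s)` for `t, s` in `T = Ĥ ⊗ H`. Two facts carry the proof. First,
`b` is multiplicative in each variable (`isSkewPairing_ev`), so `ω(t, s s') = ω(t₁, s) ω(t₂, s')`,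
and likewise for `ω⁻¹`. Second, `H` is cocommutative, so the `H`-component of `t` may be
interchanged with `t` itself (`indep_comp_snd`): `snd t₁ ⊗ t₂ = snd t₂ ⊗ t₁`.

Suppressing coproduct indices, the deformed product is `t ∘ s = ω(t,s) t s ω⁻¹(t,s)`, hence `t ∘ (s
s') = ω(t,s) ω(t,s') t s s' ω⁻¹(t,s) ω⁻¹(t,s')`. The right side of the brace identity is `ω(t,s) t s
ω⁻¹(t,s) · S(t) · ω(t,s') t s' ω⁻¹(t,s')`. By the second fact `ω(t,s')` moves left past `t`, so
`S(t) t` cancels; the remaining scalars move into place because `t, s, s'` are independent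
variables. This is `lift_mul_twistMul`, with its algebra isolated in `mul_twist_compat`.

Everything is computed in convolution monoids `X ⟶ A`. An equality of morphisms out of a tensor
product is tested on the projections, which act as independent generic elements. The symmetry
survives only as the relation `Indep`, and independence of a scalar from a morphism becomes an
honest `Commute` in a monoid. Associativity of the deformed product (`lift_twistMul_assoc`) comes
from the same rules, and its antipode from the factorization of the identity through `A` and `H`.
The Hopf algebra `Ĥ` is obtained by transposing identities along the nondegenerate pairing. A type
synonym `DualObj` carries its instances, and the final theorem follows by unfolding it. -/

namespace HopfBraces

open scoped MonObj ComonObj HopfObj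

noncomputable section

/-! ### Calculus of generic elements: pairing of morphisms, convolution and independence. -/

section Calculus

variable {C : Type u} [Category.{v} C] [MonoidalCategory C]

/-- The morphism `x ↦ f(x₁) ⊗ g(x₂)`. -/
def lift {X Y Z : C} [ComonObj X] (f : X ⟶ Y) (g : X ⟶ Z) : X ⟶ Y ⊗ Z := Δ[X] ≫ (f ⊗ₘ g)

/-- The projection onto the first factor given by the counit of the second. -/
def fst (X Y : C) [ComonObj Y] : X ⊗ Y ⟶ X := X ◁ ε[Y] ≫ (ρ_ X).hom

/-- The projection onto the second factor given by the counit of the first. -/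
def snd (X Y : C) [ComonObj X] : X ⊗ Y ⟶ Y := ε[X] ▷ Y ≫ (λ_ Y).hom

theorem fst_eq (X Y : C) [ComonObj Y] : fst X Y = (𝟙 X ⊗ₘ ε[Y]) ≫ (ρ_ X).hom := by
  simp [fst]

theorem snd_eq (X Y : C) [ComonObj X] : snd X Y = (ε[X] ⊗ₘ 𝟙 Y) ≫ (λ_ Y).hom := by
  simp [snd]

section Lift

variable {X Y Z W : C} [ComonObj X]

theorem lift_map {Y' Z' : C} (f : X ⟶ Y) (g : X ⟶ Z) (h : Y ⟶ Y') (k : Z ⟶ Z') :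
    lift f g ≫ (h ⊗ₘ k) = lift (f ≫ h) (g ≫ k) := by
  simp [lift]

theorem lift_map_assoc {Y' Z' V : C} (f : X ⟶ Y) (g : X ⟶ Z) (h : Y ⟶ Y') (k : Z ⟶ Z')
    (l : Y' ⊗ Z' ⟶ V) :
    lift f g ≫ (h ⊗ₘ k) ≫ l = lift (f ≫ h) (g ≫ k) ≫ l := by
  rw [← Category.assoc, lift_map]

theorem lift_whiskerLeft {Z' : C} (f : X ⟶ Y) (g : X ⟶ Z) (k : Z ⟶ Z') :
    lift f g ≫ Y ◁ k = lift f (g ≫ k) := by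
  rw [← id_tensorHom, lift_map, Category.comp_id]

theorem lift_whiskerLeft_assoc {Z' V : C} (f : X ⟶ Y) (g : X ⟶ Z) (k : Z ⟶ Z')
    (l : Y ⊗ Z' ⟶ V) :
    lift f g ≫ Y ◁ k ≫ l = lift f (g ≫ k) ≫ l := by
  rw [← Category.assoc, lift_whiskerLeft]

theorem lift_whiskerRight {Y' : C} (f : X ⟶ Y) (g : X ⟶ Z) (h : Y ⟶ Y') :
    lift f g ≫ h ▷ Z = lift (f ≫ h) g := by
  rw [← tensorHom_id, lift_map, Category.comp_id]

theorem lift_whiskerRight_assoc {Y' V : C} (f : X ⟶ Y) (g : X ⟶ Z) (h : Y ⟶ Y')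
    (l : Y' ⊗ Z ⟶ V) :
    lift f g ≫ h ▷ Z ≫ l = lift (f ≫ h) g ≫ l := by
  rw [← Category.assoc, lift_whiskerRight]

theorem comp_lift [ComonObj W] (h : W ⟶ X) [IsComonHom h] (f : X ⟶ Y) (g : X ⟶ Z) :
    h ≫ lift f g = lift (h ≫ f) (h ≫ g) := by
  simp [lift]

theorem comp_lift_assoc {V : C} [ComonObj W] (h : W ⟶ X) [IsComonHom h] (f : X ⟶ Y) (g : X ⟶ Z)
    (l : Y ⊗ Z ⟶ V) :
    h ≫ lift f g ≫ l = lift (h ≫ f) (h ≫ g) ≫ l := by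
  rw [← Category.assoc, comp_lift]

theorem lift_id_id : lift (𝟙 X) (𝟙 X) = Δ[X] := by simp [lift]

theorem lift_assoc (f : X ⟶ Y) (g : X ⟶ Z) (h : X ⟶ W) :
    lift (lift f g) h ≫ (α_ Y Z W).hom = lift f (lift g h) := by
  have : lift (lift f g) h = Δ[X] ≫ Δ[X] ▷ X ≫ ((f ⊗ₘ g) ⊗ₘ h) := by
    simp [lift, MonoidalCategory.tensorHom_def]
  rw [this, Category.assoc, Category.assoc, associator_naturality, ← ComonObj.comul_assoc_assoc,
    lift, lift, ← id_tensorHom, tensorHom_comp_tensorHom, Category.id_comp]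

theorem lift_assoc_assoc {V : C} (f : X ⟶ Y) (g : X ⟶ Z) (h : X ⟶ W) (l : Y ⊗ Z ⊗ W ⟶ V) :
    lift (lift f g) h ≫ (α_ Y Z W).hom ≫ l = lift f (lift g h) ≫ l := by
  rw [← Category.assoc, lift_assoc]

theorem lift_assoc_inv (f : X ⟶ Y) (g : X ⟶ Z) (h : X ⟶ W) :
    lift f (lift g h) ≫ (α_ Y Z W).inv = lift (lift f g) h := by
  rw [← lift_assoc, Category.assoc, Iso.hom_inv_id, Category.comp_id]

theorem lift_assoc_inv_assoc {V : C} (f : X ⟶ Y) (g : X ⟶ Z) (h : X ⟶ W) (l : (Y ⊗ Z) ⊗ W ⟶ V) :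
    lift f (lift g h) ≫ (α_ Y Z W).inv ≫ l = lift (lift f g) h ≫ l := by
  rw [← Category.assoc, lift_assoc_inv]

theorem lift_counit_left (g : X ⟶ Z) : lift ε[X] g = g ≫ (λ_ Z).inv := by
  simp [lift]

theorem lift_counit_left_assoc {V : C} (g : X ⟶ Z) (l : 𝟙_ C ⊗ Z ⟶ V) :
    lift ε[X] g ≫ l = g ≫ (λ_ Z).inv ≫ l := by
  rw [← Category.assoc, lift_counit_left, Category.assoc]

theorem lift_counit_right (g : X ⟶ Z) : lift g ε[X] = g ≫ (ρ_ Z).inv := by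
  simp [lift]

theorem lift_counit_right_assoc {V : C} (g : X ⟶ Z) (l : Z ⊗ 𝟙_ C ⟶ V) :
    lift g ε[X] ≫ l = g ≫ (ρ_ Z).inv ≫ l := by
  rw [← Category.assoc, lift_counit_right, Category.assoc]

theorem lift_fst [ComonObj Z] (f : X ⟶ Y) (g : X ⟶ Z) (hg : g ≫ ε[Z] = ε[X]) :
    lift f g ≫ fst Y Z = f := by
  rw [fst, lift_whiskerLeft_assoc, hg, lift_counit_right]; simp

theorem lift_snd [ComonObj Y] (f : X ⟶ Y) (g : X ⟶ Z) (hf : f ≫ ε[Y] = ε[X]) :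
    lift f g ≫ snd Y Z = g := by
  rw [snd, lift_whiskerRight_assoc, hf, lift_counit_left]; simp

end Lift

section Conv

variable {X A B W : C} [ComonObj X] [MonObj A] [MonObj B]

/-- The convolution product on the morphisms from a comonoid to a monoid. -/
scoped instance convMonoid : Monoid (X ⟶ A) where
  mul f g := lift f g ≫ μ[A]
  one := ε[X] ≫ η[A]
  one_mul f := by
    change lift (ε[X] ≫ η[A]) f ≫ μ[A] = f
    rw [← lift_whiskerRight_assoc, lift_counit_left]; simp
  mul_one f := by
    change lift f (ε[X] ≫ η[A]) ≫ μ[A] = f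
    rw [← lift_whiskerLeft_assoc, lift_counit_right]; simp
  mul_assoc f g h := by
    change lift (lift f g ≫ μ[A]) h ≫ μ[A] = lift f (lift g h ≫ μ[A]) ≫ μ[A]
    rw [← lift_whiskerRight_assoc, ← lift_whiskerLeft_assoc, ← lift_assoc_assoc]
    simp

theorem conv_mul_def (f g : X ⟶ A) : f * g = lift f g ≫ μ[A] := rfl

theorem conv_one_def : (1 : X ⟶ A) = ε[X] ≫ η[A] := rfl

theorem comp_conv_mul [ComonObj W] (h : W ⟶ X) [IsComonHom h] (f g : X ⟶ A) :
    h ≫ (f * g) = (h ≫ f) * (h ≫ g) := by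
  rw [conv_mul_def, comp_lift_assoc]; rfl

theorem comp_conv_one [ComonObj W] (h : W ⟶ X) [IsComonHom h] :
    h ≫ (1 : X ⟶ A) = 1 := by
  simp [conv_one_def]

/-- Applied with `k = η[A]`, this embeds scalar-valued morphisms multiplicatively into every `X ⟶
A`. -/
theorem conv_mul_comp (f g : X ⟶ A) (k : A ⟶ B) [IsMonHom k] :
    (f * g) ≫ k = (f ≫ k) * (g ≫ k) := by
  rw [conv_mul_def, conv_mul_def, Category.assoc, IsMonHom.mul_hom, lift_map_assoc]

theorem conv_one_comp (k : A ⟶ B) [IsMonHom k] : (1 : X ⟶ A) ≫ k = 1 := by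
  simp [conv_one_def]

instance isMonHom_one : IsMonHom η[A] where
  one_hom := by change 𝟙 _ ≫ _ = _; simp
  mul_hom := by change (λ_ _).hom ≫ _ = _; simp [MonoidalCategory.tensorHom_def, unitors_equal]

/-- A scalar, that is, a morphism to the unit object, as an element of `X ⟶ A`. -/
def scal (A : C) [MonObj A] (a : X ⟶ 𝟙_ C) : X ⟶ A := a ≫ η[A]

theorem scal_mul (a b : X ⟶ 𝟙_ C) : scal A (a * b) = scal A a * scal A b :=
  conv_mul_comp a b η[A]

theorem scal_one : scal A (1 : X ⟶ 𝟙_ C) = 1 := conv_one_comp η[A]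

omit [ComonObj X] in
theorem scal_unit (a : X ⟶ 𝟙_ C) : scal (𝟙_ C) a = a := Category.comp_id a

omit [ComonObj X] in
theorem scal_comp (a : X ⟶ 𝟙_ C) (k : A ⟶ B) [IsMonHom k] : scal A a ≫ k = scal B a := by
  simp [scal]

omit [ComonObj X] in
theorem comp_scal (h : W ⟶ X) (a : X ⟶ 𝟙_ C) : h ≫ scal A a = scal A (h ≫ a) := by
  simp [scal]

theorem scal_mul_eq_lift (a : X ⟶ 𝟙_ C) (f : X ⟶ A) :
    scal A a * f = lift a f ≫ (λ_ A).hom := by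
  rw [conv_mul_def, scal, ← lift_whiskerRight_assoc]; simp

theorem mul_scal_eq_lift (a : X ⟶ 𝟙_ C) (f : X ⟶ A) :
    f * scal A a = lift f a ≫ (ρ_ A).hom := by
  rw [conv_mul_def, scal, ← lift_whiskerLeft_assoc]; simp

theorem conv_unit_mul_def (a b : X ⟶ 𝟙_ C) : a * b = lift a b ≫ (λ_ (𝟙_ C)).hom := rfl

end Conv

section Braided

variable [BraidedCategory C] {X Y Z W V : C} [ComonObj X]

/-- The values of `f` and `g` can be interchanged: `f(x₁) ⊗ g(x₂) = f(x₂) ⊗ g(x₁)`. -/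
def Indep (f : X ⟶ Y) (g : X ⟶ Z) : Prop := lift f g ≫ (β_ Y Z).hom = lift g f

theorem Indep.comp {f : X ⟶ Y} {g : X ⟶ Z} (h : Indep f g) {Y' Z' : C} (p : Y ⟶ Y')
    (q : Z ⟶ Z') : Indep (f ≫ p) (g ≫ q) := by
  unfold Indep at *
  rw [← lift_map, Category.assoc, BraidedCategory.braiding_naturality, reassoc_of% h, lift_map]

theorem Indep.comp_left {f : X ⟶ Y} {g : X ⟶ Z} (h : Indep f g) {Y' : C} (p : Y ⟶ Y') :
    Indep (f ≫ p) g := by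
  simpa using h.comp p (𝟙 Z)

theorem Indep.comp_right {f : X ⟶ Y} {g : X ⟶ Z} (h : Indep f g) {Z' : C} (q : Z ⟶ Z') :
    Indep f (g ≫ q) := by
  simpa using h.comp (𝟙 Y) q

theorem Indep.precomp {f : X ⟶ Y} {g : X ⟶ Z} (h : Indep f g) [ComonObj W] (k : W ⟶ X)
    [IsComonHom k] : Indep (k ≫ f) (k ≫ g) := by
  unfold Indep at *
  rw [← comp_lift, Category.assoc, h, comp_lift]

theorem Indep.lift_left {f : X ⟶ Y} {g : X ⟶ Z} {k : X ⟶ W} (hf : Indep f k) (hg : Indep g k) :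
    Indep (lift f g) k := by
  unfold Indep at *
  have : (β_ (Y ⊗ Z) W).hom = (α_ Y Z W).hom ≫ Y ◁ (β_ Z W).hom ≫ (α_ Y W Z).inv ≫
      (β_ Y W).hom ▷ Z ≫ (α_ W Y Z).hom := by
    simp
  rw [this, lift_assoc_assoc, lift_whiskerLeft_assoc, hg, lift_assoc_inv_assoc,
    lift_whiskerRight_assoc, hf, lift_assoc]

theorem indep_counit_left (g : X ⟶ Z) : Indep ε[X] g := by
  unfold Indep
  rw [lift_counit_left, lift_counit_right]; simp [braiding_tensorUnit_left]

theorem indep_counit_right (g : X ⟶ Z) : Indep g ε[X] := by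
  unfold Indep
  rw [lift_counit_left, lift_counit_right]; simp [braiding_tensorUnit_right]

/-- The main gateway by which cocommutativity enters: even two copies of the same variable are
independent. -/
theorem indep_of_comm [IsCommComonObj X] (f : X ⟶ Y) (g : X ⟶ Z) : Indep f g := by
  have : Indep (𝟙 X) (𝟙 X) := by
    unfold Indep
    rw [lift_id_id, IsCommComonObj.comul_comm]
  simpa using this.comp f g

/-- Only the two inner entries cross in the middle-four interchange, so only their independence
matters. -/
theorem lift_tensorμ {Y₁ Y₂ Z₁ Z₂ : C} (p : X ⟶ Y₁) (q : X ⟶ Y₂) (r : X ⟶ Z₁) (s : X ⟶ Z₂)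
    (h : Indep q r) :
    lift (lift p q) (lift r s) ≫ tensorμ Y₁ Y₂ Z₁ Z₂ = lift (lift p r) (lift q s) := by
  unfold Indep at h
  rw [tensorμ, lift_assoc_assoc, lift_whiskerLeft_assoc, lift_assoc_inv, lift_whiskerLeft_assoc,
    lift_whiskerRight, h, lift_whiskerLeft_assoc, lift_assoc, lift_assoc_inv]

theorem lift_tensorμ_assoc {Y₁ Y₂ Z₁ Z₂ V : C} (p : X ⟶ Y₁) (q : X ⟶ Y₂) (r : X ⟶ Z₁) (s : X ⟶ Z₂)
    (h : Indep q r) (l : (Y₁ ⊗ Z₁) ⊗ (Y₂ ⊗ Z₂) ⟶ V) :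
    lift (lift p q) (lift r s) ≫ tensorμ Y₁ Y₂ Z₁ Z₂ ≫ l = lift (lift p r) (lift q s) ≫ l := by
  rw [← Category.assoc, lift_tensorμ p q r s h]

theorem Indep.isComonHom_lift [ComonObj Y] [ComonObj Z] {f : X ⟶ Y} {g : X ⟶ Z} [IsComonHom f]
    [IsComonHom g] (h : Indep f g) : IsComonHom (lift f g) where
  hom_counit := by
    simp [lift_map_assoc, lift_counit_left]
  hom_comul := by
    have hf : f ≫ Δ[Y] = lift f f := IsComonHom.hom_comul f
    have hg : g ≫ Δ[Z] = lift g g := IsComonHom.hom_comul g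
    rw [Comon.tensorObj_comul, lift_map_assoc, hf, hg, lift_tensorμ _ _ _ _ h]
    rfl

theorem lift_fst_snd (X Y : C) [ComonObj X] [ComonObj Y] : lift (fst X Y) (snd X Y) = 𝟙 _ := by
  rw [lift, fst_eq, snd_eq, Comon.tensorObj_comul, ← tensorHom_comp_tensorHom, Category.assoc,
    ← tensorμ_natural_assoc, tensorHom_comp_tensorHom_assoc]
  simp only [tensorμ, id_tensorHom, tensorHom_id, ComonObj.comul_counit, ComonObj.counit_comul,
    braiding_tensorUnit_left]
  monoidal

instance isComonHom_fst (X Y : C) [ComonObj X] [ComonObj Y] : IsComonHom (fst X Y) where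
  hom_counit := by
    rw [fst, Category.assoc, ← rightUnitor_naturality, whisker_exchange_assoc]
    simp [MonoidalCategory.tensorHom_def, unitors_equal]
  hom_comul := by
    rw [fst_eq, Comon.tensorObj_comul, ← tensorHom_comp_tensorHom, Category.assoc,
      Category.assoc, ← tensorμ_natural_assoc, tensorHom_comp_tensorHom_assoc]
    simp only [tensorμ, ComonObj.comul_counit_hom, id_tensorHom, tensorHom_id,
      braiding_tensorUnit_right]
    rw [Category.assoc, ← rightUnitor_naturality, whisker_exchange_assoc,
      MonoidalCategory.tensorHom_def]
    monoidal

instance isComonHom_snd (X Y : C) [ComonObj X] [ComonObj Y] : IsComonHom (snd X Y) where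
  hom_counit := by
    rw [snd, Category.assoc, ← leftUnitor_naturality]
    simp [MonoidalCategory.tensorHom_def]
  hom_comul := by
    rw [snd_eq, Comon.tensorObj_comul, ← tensorHom_comp_tensorHom, Category.assoc,
      Category.assoc, ← tensorμ_natural_assoc, tensorHom_comp_tensorHom_assoc]
    simp only [tensorμ, ComonObj.comul_counit_hom, tensorHom_id,
      braiding_tensorUnit_left]
    rw [Category.assoc, ← leftUnitor_naturality, ← whisker_exchange_assoc,
      MonoidalCategory.tensorHom_def']
    monoidal

/-- The tensor coproduct splits the two factors separately, so they are independent without any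
cocommutativity. -/
theorem indep_fst_snd (X Y : C) [ComonObj X] [ComonObj Y] : Indep (fst X Y) (snd X Y) := by
  unfold Indep
  rw [lift_fst_snd, lift, fst_eq, snd_eq, Comon.tensorObj_comul, ← tensorHom_comp_tensorHom,
    Category.assoc, ← tensorμ_natural_assoc, tensorHom_comp_tensorHom_assoc]
  simp only [tensorμ, id_tensorHom, tensorHom_id, ComonObj.comul_counit, ComonObj.counit_comul]
  rw [MonoidalCategory.tensorHom_def]
  monoidal

end Braided

section Symmetric

variable [SymmetricCategory C] {X Y Z W V : C} [ComonObj X]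

theorem Indep.symm {f : X ⟶ Y} {g : X ⟶ Z} (h : Indep f g) : Indep g f := by
  unfold Indep at *
  rw [← h]; simp

theorem Indep.lift_right {f : X ⟶ Y} {g : X ⟶ Z} {k : X ⟶ W} (hf : Indep k f) (hg : Indep k g) :
    Indep k (lift f g) := (hf.symm.lift_left hg.symm).symm

end Symmetric

section Commute

variable [BraidedCategory C] {X Y A H : C} [ComonObj X] [MonObj A]

/-- A scalar multiplies from either side in the same way, so only the order of the coproduct factors
can obstruct commutation. -/
theorem Indep.commute_scal {a : X ⟶ 𝟙_ C} {f : X ⟶ A} (h : Indep a f) :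
    Commute (scal A a) f := by
  unfold Indep at h
  change _ * _ = _ * _
  rw [scal_mul_eq_lift, mul_scal_eq_lift, ← h]; simp

theorem Indep.commute_unit {a b : X ⟶ 𝟙_ C} (h : Indep a b) : Commute a b := by
  simpa [scal_unit] using h.commute_scal

theorem Indep.mul_left {f g : X ⟶ A} {k : X ⟶ Y} (hf : Indep f k) (hg : Indep g k) :
    Indep (f * g) k := (hf.lift_left hg).comp_left μ

theorem isComonHom_mulHom (H : C) [BimonObj H] : IsComonHom μ[H] where
  hom_comul := by simp

theorem Indep.isComonHom_mul [BimonObj H] {f g : X ⟶ H} [IsComonHom f] [IsComonHom g]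
    (h : Indep f g) : IsComonHom (f * g) :=
  haveI := h.isComonHom_lift
  haveI := isComonHom_mulHom H
  inferInstanceAs (IsComonHom (lift f g ≫ μ[H]))

end Commute

end Calculus

/-! ### Tensor products of Hopf algebras. -/

section TensorHopf

variable {C : Type u} [Category.{v} C] [MonoidalCategory C]

section

variable [BraidedCategory C] {X A B : C} [ComonObj X]

theorem mulHom_eq (A : C) [BimonObj A] : fst A A * snd A A = μ[A] := by
  rw [conv_mul_def, lift_fst_snd, Category.id_comp]

theorem lift_mul_lift [MonObj A] [MonObj B] {p p' : X ⟶ A} {q q' : X ⟶ B} (h : Indep q p') :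
    lift p q * lift p' q' = lift (p * p') (q * q') := by
  rw [conv_mul_def, MonObj.tensorObj.mul_def, lift_tensorμ_assoc _ _ _ _ h, lift_map]; rfl

theorem lift_one_one [MonObj A] [MonObj B] : lift (1 : X ⟶ A) (1 : X ⟶ B) = 1 := by
  rw [conv_one_def, conv_one_def, conv_one_def, ← lift_map, lift_counit_left,
    MonObj.tensorObj.one_def]
  simp

instance isComonHom_conv_one [BimonObj A] : IsComonHom (1 : X ⟶ A) where
  hom_counit := by simp [conv_one_def]
  hom_comul := by
    have h : (1 : X ⟶ A) ≫ Δ[A] = 1 := by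
      rw [conv_one_def, conv_one_def, Category.assoc, BimonObj.one_comul]
    rw [h, ← lift_one_one]; rfl

theorem indep_one_left [MonObj A] {Z : C} (f : X ⟶ Z) : Indep (1 : X ⟶ A) f :=
  (indep_counit_left f).comp_left _

theorem indep_one_right [MonObj A] {Z : C} (f : X ⟶ Z) : Indep f (1 : X ⟶ A) :=
  (indep_counit_right f).comp_right _

instance isMonHom_counit (A : C) [BimonObj A] : IsMonHom ε[A] where
  one_hom := BimonObj.one_counit A
  mul_hom := BimonObj.mul_counit A

instance isMonHom_comul (A : C) [BimonObj A] : IsMonHom Δ[A] where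
  one_hom := BimonObj.one_comul A
  mul_hom := by rw [BimonObj.mul_comul, MonObj.tensorObj.mul_def]

/-- The embedding of the first tensor factor given by the unit of the second. -/
def inl (A B : C) [MonObj B] : A ⟶ A ⊗ B := (ρ_ A).inv ≫ A ◁ η[B]

/-- The embedding of the second tensor factor given by the unit of the first. -/
def inr (A B : C) [MonObj A] : B ⟶ A ⊗ B := (λ_ B).inv ≫ η[A] ▷ B

instance isMonHom_inl (A B : C) [MonObj A] [MonObj B] : IsMonHom (inl A B) := by
  unfold inl; infer_instance

instance isMonHom_inr (A B : C) [MonObj A] [MonObj B] : IsMonHom (inr A B) := by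
  unfold inr; infer_instance

omit [BraidedCategory C] in
theorem comp_inl [MonObj B] (f : X ⟶ A) : f ≫ inl A B = lift f 1 := by
  rw [conv_one_def, ← lift_whiskerLeft, lift_counit_right, inl, Category.assoc]

omit [BraidedCategory C] in
theorem comp_inr [MonObj A] (g : X ⟶ B) : g ≫ inr A B = lift 1 g := by
  rw [conv_one_def, ← lift_whiskerRight, lift_counit_left, inr, Category.assoc]

/-- Turns pairings into convolution products, so that statements about `lift` become monoid
computations. -/
theorem comp_inl_mul_comp_inr [MonObj A] [MonObj B] (f : X ⟶ A) (g : X ⟶ B) :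
    (f ≫ inl A B) * (g ≫ inr A B) = lift f g := by
  rw [comp_inl, comp_inr, lift_mul_lift (indep_one_left _), mul_one, one_mul]

theorem antipode_mul_id (A : C) [HopfObj A] : 𝒮[A] * 𝟙 A = 1 := by
  rw [conv_mul_def, lift, tensorHom_id, Category.assoc, HopfObj.antipode_left]; rfl

theorem id_mul_antipode (A : C) [HopfObj A] : 𝟙 A * 𝒮[A] = 1 := by
  rw [conv_mul_def, lift, id_tensorHom, Category.assoc, HopfObj.antipode_right]; rfl

theorem comp_antipode_mul [HopfObj A] (f : X ⟶ A) [IsComonHom f] : (f ≫ 𝒮[A]) * f = 1 := by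
  rw [← comp_conv_one f, ← antipode_mul_id, comp_conv_mul, Category.comp_id]

theorem mul_comp_antipode [HopfObj A] (f : X ⟶ A) [IsComonHom f] : f * (f ≫ 𝒮[A]) = 1 := by
  rw [← comp_conv_one f, ← id_mul_antipode, comp_conv_mul, Category.comp_id]

end

variable [SymmetricCategory C] (A B : C)

section Bimon

variable [BimonObj A] [BimonObj B]

theorem tensor_mulHom_eq : μ[A ⊗ B] =
    lift ((fst (A ⊗ B) (A ⊗ B) ≫ fst A B) * (snd (A ⊗ B) (A ⊗ B) ≫ fst A B))
      ((fst (A ⊗ B) (A ⊗ B) ≫ snd A B) * (snd (A ⊗ B) (A ⊗ B) ≫ snd A B)) := by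
  rw [← lift_mul_lift, ← comp_lift, ← comp_lift, lift_fst_snd, Category.comp_id, Category.comp_id,
    conv_mul_def, lift_fst_snd, Category.id_comp]
  exact (indep_fst_snd _ _).comp _ _

/-- Each component of the product is a convolution product of independent comonoid morphisms, and
the two components are independent of each other. -/
theorem isComonHom_tensor_mulHom : IsComonHom μ[A ⊗ B] := by
  rw [tensor_mulHom_eq]
  have hs := indep_fst_snd (A ⊗ B) (A ⊗ B)
  have h1 : Indep (fst (A ⊗ B) (A ⊗ B) ≫ fst A B) (snd (A ⊗ B) (A ⊗ B) ≫ fst A B) := hs.comp _ _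
  have h2 : Indep (fst (A ⊗ B) (A ⊗ B) ≫ snd A B) (snd (A ⊗ B) (A ⊗ B) ≫ snd A B) := hs.comp _ _
  have := h1.isComonHom_mul
  have := h2.isComonHom_mul
  refine Indep.isComonHom_lift (Indep.mul_left ?_ ?_)
  · exact (Indep.mul_left ((indep_fst_snd A B).precomp _).symm (hs.comp _ _).symm).symm
  · exact (Indep.mul_left (hs.comp _ _) ((indep_fst_snd A B).precomp _).symm).symm

theorem one_counit_tensor : η[A ⊗ B] ≫ ε[A ⊗ B] = 𝟙 _ := by
  simp [MonObj.tensorObj.one_def]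

instance bimonObjTensor : BimonObj (A ⊗ B) where
  toMonObj := inferInstance
  toComonObj := inferInstance
  mul_comul := by
    have := isComonHom_tensor_mulHom A B
    rw [IsComonHom.hom_comul, Comon.tensorObj_comul (A ⊗ B), Category.assoc]
  one_comul := by
    have h : (1 : A ⊗ B ⟶ A ⊗ B) ≫ Δ[A ⊗ B] = 1 := by
      have : IsComonHom (1 : A ⊗ B ⟶ A ⊗ B) := by
        rw [← lift_one_one]
        exact Indep.isComonHom_lift (indep_one_left _)
      rw [this.hom_comul]
      exact lift_one_one
    -- The identity holds after the counit; since `η ≫ ε` is the identity, precomposing with `η`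
    -- removes it.
    have h' := congrArg (η[A ⊗ B] ≫ ·) h
    simpa only [conv_one_def, Category.assoc, reassoc_of% one_counit_tensor A B] using h'
  mul_counit := (isComonHom_tensor_mulHom A B).hom_counit
  one_counit := one_counit_tensor A B

end Bimon

instance hopfObjTensor [HopfObj A] [HopfObj B] : HopfObj (A ⊗ B) where
  antipode := 𝒮[A] ⊗ₘ 𝒮[B]
  antipode_left := by
    have h : 𝒮[A] ⊗ₘ 𝒮[B] = lift (fst A B ≫ 𝒮[A]) (snd A B ≫ 𝒮[B]) := by
      rw [← lift_map, lift_fst_snd, Category.id_comp]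
    have e : (𝒮[A] ⊗ₘ 𝒮[B]) * 𝟙 (A ⊗ B) = 1 := by
      rw [h, ← lift_fst_snd A B, lift_mul_lift, comp_antipode_mul, comp_antipode_mul, lift_one_one]
      exact (indep_fst_snd A B).symm.comp_left _
    rw [conv_mul_def, lift, tensorHom_id, Category.assoc] at e
    exact e
  antipode_right := by
    have h : 𝒮[A] ⊗ₘ 𝒮[B] = lift (fst A B ≫ 𝒮[A]) (snd A B ≫ 𝒮[B]) := by
      rw [← lift_map, lift_fst_snd, Category.id_comp]
    have e : 𝟙 (A ⊗ B) * (𝒮[A] ⊗ₘ 𝒮[B]) = 1 := by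
      rw [h, ← lift_fst_snd A B, lift_mul_lift, mul_comp_antipode, mul_comp_antipode, lift_one_one]
      exact (indep_fst_snd A B).symm.comp_right _
    rw [conv_mul_def, lift, id_tensorHom, Category.assoc] at e
    exact e

end TensorHopf

/-! ### Skew pairings and their convolution inverses. -/

section Pairing

variable {C : Type u} [Category.{v} C] [MonoidalCategory C] [BraidedCategory C]

/-- A pairing of bimonoids with the conventions `b(hk, f) = b(k, f₁) b(h, f₂)` and
`b(h, fg) = b(h₁, f) b(h₂, g)`. -/
structure IsSkewPairing {H A : C} [MonObj H] [ComonObj H] [MonObj A] [ComonObj A]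
    (b : H ⊗ A ⟶ 𝟙_ C) : Prop where
  mul_left : μ[H] ▷ A ≫ b =
    ((β_ H H).hom ⊗ₘ Δ[A]) ≫ tensorμ H H A A ≫ (b ⊗ₘ b) ≫ (λ_ (𝟙_ C)).hom
  mul_right : H ◁ μ[A] ≫ b =
    Δ[H] ▷ (A ⊗ A) ≫ tensorμ H H A A ≫ (b ⊗ₘ b) ≫ (λ_ (𝟙_ C)).hom
  one_left : η[H] ▷ A ≫ b = (λ_ A).hom ≫ ε[A]
  one_right : H ◁ η[A] ≫ b = (ρ_ H).hom ≫ ε[H]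

namespace IsSkewPairing

section

variable {H A X : C} [MonObj H] [ComonObj H] [MonObj A] [ComonObj A] [ComonObj X]
  {b : H ⊗ A ⟶ 𝟙_ C} (hb : IsSkewPairing b)

include hb

theorem lift_mul_left {v v' : X ⟶ H} {u : X ⟶ A} [IsComonHom u] (hv : Indep v v')
    (hu : Indep v u) : lift (v * v') u ≫ b = (lift v' u ≫ b) * (lift v u ≫ b) := by
  have hΔ : u ≫ Δ[A] = lift u u := IsComonHom.hom_comul u
  unfold Indep at hv
  rw [conv_mul_def, ← lift_whiskerRight_assoc, hb.mul_left, lift_map_assoc, hv, hΔ,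
    lift_tensorμ_assoc _ _ _ _ hu, lift_map_assoc, conv_unit_mul_def]

theorem lift_mul_right {v : X ⟶ H} {u u' : X ⟶ A} [IsComonHom v] (hu : Indep v u) :
    lift v (u * u') ≫ b = (lift v u ≫ b) * (lift v u' ≫ b) := by
  have hΔ : v ≫ Δ[H] = lift v v := IsComonHom.hom_comul v
  rw [conv_mul_def, ← lift_whiskerLeft_assoc, hb.mul_right, lift_whiskerRight_assoc, hΔ,
    lift_tensorμ_assoc _ _ _ _ hu, lift_map_assoc, conv_unit_mul_def]

theorem lift_one_left (u : X ⟶ A) (hu : u ≫ ε[A] = ε[X]) : lift (1 : X ⟶ H) u ≫ b = 1 := by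
  rw [conv_one_def, ← lift_whiskerRight_assoc, hb.one_left, lift_counit_left_assoc,
    Iso.inv_hom_id_assoc, hu, conv_one_def]
  exact (Category.comp_id _).symm

theorem lift_scal_right (v : X ⟶ H) (hv : v ≫ ε[H] = ε[X]) (a : X ⟶ 𝟙_ C) :
    lift v (scal A a) ≫ b = a := by
  rw [scal, ← lift_whiskerLeft_assoc, hb.one_right, ← rightUnitor_naturality,
    lift_whiskerRight_assoc, hv, lift_counit_left_assoc, ← unitors_equal, Iso.inv_hom_id,
    Category.comp_id]

theorem lift_one_right (v : X ⟶ H) (hv : v ≫ ε[H] = ε[X]) : lift v (1 : X ⟶ A) ≫ b = 1 := by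
  rw [← scal_one, hb.lift_scal_right v hv]

end

end IsSkewPairing

end Pairing

section Pairing

variable {C : Type u} [Category.{v} C] [MonoidalCategory C] [SymmetricCategory C]

namespace IsSkewPairing

variable {H A X : C} [HopfObj H] [IsCommComonObj H] [ComonObj X]

instance isComonHom_antipode : IsComonHom 𝒮[H] where
  hom_counit := HopfObj.antipode_counit H
  hom_comul := by
    rw [HopfObj.antipode_comul, IsCommComonObj.comul_comm_assoc]

section

variable [MonObj A] [ComonObj A] {b : H ⊗ A ⟶ 𝟙_ C} (hb : IsSkewPairing b)

include hb

/-- Multiplicativity in `H` turns the product into `b(S(v₁) v₂, u)`, which is `b(1, u)`; splitting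
the pairing this way needs `S(v)` and `v` independent, hence cocommutativity. -/
theorem mul_lift_antipode {v : X ⟶ H} {u : X ⟶ A} [IsComonHom v] [IsComonHom u]
    (h : Indep v u) : (lift v u ≫ b) * (lift (v ≫ 𝒮[H]) u ≫ b) = 1 := by
  rw [← hb.lift_mul_left _ (h.comp_left _), comp_antipode_mul, hb.lift_one_left u (by simp)]
  simpa using (indep_of_comm 𝒮[H] (𝟙 H)).precomp v

theorem lift_antipode_mul {v : X ⟶ H} {u : X ⟶ A} [IsComonHom v] [IsComonHom u]
    (h : Indep v u) : (lift (v ≫ 𝒮[H]) u ≫ b) * (lift v u ≫ b) = 1 := by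
  rw [← hb.lift_mul_left _ h, mul_comp_antipode, hb.lift_one_left u (by simp)]
  simpa using (indep_of_comm (𝟙 H) 𝒮[H]).precomp v

end

variable [HopfObj A] {b : H ⊗ A ⟶ 𝟙_ C} (hb : IsSkewPairing b)

include hb

/-- Both sides are convolution inverses of `b(v, u)`, one through the antipode of each factor. -/
theorem lift_comp_antipode {v : X ⟶ H} {u : X ⟶ A} [IsComonHom v] [IsComonHom u]
    (h : Indep v u) : lift v (u ≫ 𝒮[A]) ≫ b = lift (v ≫ 𝒮[H]) u ≫ b := by
  refine (left_inv_eq_right_inv (hb.lift_antipode_mul h) ?_).symm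
  rw [← hb.lift_mul_right h, mul_comp_antipode, hb.lift_one_right v (by simp)]

end IsSkewPairing

end Pairing

/-! ### The product deformed by the cocycle of a skew pairing. -/

section Twist

variable {C : Type u} [Category.{v} C] [MonoidalCategory C] [SymmetricCategory C]

variable {H A : C} [HopfObj H] [IsCommComonObj H] [HopfObj A]

/-- The two-cocycle `b(v, u)` on `A ⊗ H` given by a pairing `b`, evaluated at two morphisms to
`A ⊗ H`. -/
def cocyc {X : C} [ComonObj X] (b : H ⊗ A ⟶ 𝟙_ C) (t t' : X ⟶ A ⊗ H) : X ⟶ 𝟙_ C :=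
  lift (t ≫ snd A H) (t' ≫ fst A H) ≫ b

/-- The convolution inverse of `cocyc`. -/
def cocycInv {X : C} [ComonObj X] (b : H ⊗ A ⟶ 𝟙_ C) (t t' : X ⟶ A ⊗ H) : X ⟶ 𝟙_ C :=
  lift (t ≫ snd A H ≫ 𝒮[H]) (t' ≫ fst A H) ≫ b

/-- The product of `A ⊗ H` deformed by the two-cocycle. -/
def twistMul (b : H ⊗ A ⟶ 𝟙_ C) : (A ⊗ H) ⊗ (A ⊗ H) ⟶ A ⊗ H :=
  scal (A ⊗ H) (cocyc b (fst _ _) (snd _ _)) * μ[A ⊗ H] *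
    scal (A ⊗ H) (cocycInv b (fst _ _) (snd _ _))

variable {X : C} [ComonObj X] {b : H ⊗ A ⟶ 𝟙_ C}

instance isMonHom_fst : IsMonHom (fst A H) := by
  unfold fst
  infer_instance

instance isMonHom_snd : IsMonHom (snd A H) := by
  unfold snd
  infer_instance

/-- The form in which cocommutativity of `H` is used below: the `H`-component is independent of the
whole element, although `A ⊗ H` need not be cocommutative. -/
theorem indep_snd_id : Indep (snd A H) (𝟙 (A ⊗ H)) := by
  rw [← lift_fst_snd]
  exact Indep.lift_right (indep_fst_snd A H).symm
    (by simpa using (indep_of_comm (𝟙 H) (𝟙 H)).precomp (snd A H))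

theorem indep_comp_snd (t : X ⟶ A ⊗ H) [IsComonHom t] : Indep (t ≫ snd A H) t := by
  simpa using indep_snd_id.precomp t

omit [IsCommComonObj H] in
theorem comp_cocyc {W : C} [ComonObj W] (h : W ⟶ X) [IsComonHom h] (t t' : X ⟶ A ⊗ H) :
    h ≫ cocyc b t t' = cocyc b (h ≫ t) (h ≫ t') := by
  simp [cocyc, comp_lift_assoc]

omit [IsCommComonObj H] in
theorem comp_cocycInv {W : C} [ComonObj W] (h : W ⟶ X) [IsComonHom h] (t t' : X ⟶ A ⊗ H) :
    h ≫ cocycInv b t t' = cocycInv b (h ≫ t) (h ≫ t') := by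
  simp [cocycInv, comp_lift_assoc]

omit [IsCommComonObj H] in
theorem Indep.cocyc {Z : C} {t t' : X ⟶ A ⊗ H} {k : X ⟶ Z} (h : Indep (t ≫ snd A H) k)
    (h' : Indep (t' ≫ fst A H) k) : Indep (cocyc b t t') k :=
  (h.lift_left h').comp_left b

omit [IsCommComonObj H] in
theorem Indep.cocycInv {Z : C} {t t' : X ⟶ A ⊗ H} {k : X ⟶ Z} (h : Indep (t ≫ snd A H) k)
    (h' : Indep (t' ≫ fst A H) k) : Indep (cocycInv b t t') k :=
  Indep.comp_left (Indep.lift_left (by simpa using h.comp_left 𝒮[H]) h') b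

omit [IsCommComonObj H] in
/-- The value of the deformed product at a pair of independent morphisms of comonoids. -/
theorem lift_twistMul {t t' : X ⟶ A ⊗ H} [IsComonHom t] [IsComonHom t'] (h : Indep t t') :
    lift t t' ≫ twistMul b = scal (A ⊗ H) (cocyc b t t') * (t * t') *
      scal (A ⊗ H) (cocycInv b t t') := by
  have := h.isComonHom_lift
  rw [twistMul, comp_conv_mul, comp_conv_mul, comp_scal, comp_scal, comp_cocyc, comp_cocycInv,
    lift_fst _ _ (IsComonHom.hom_counit t'), lift_snd _ _ (IsComonHom.hom_counit t),
    conv_mul_def t t']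

section

variable (hb : IsSkewPairing b)

include hb

theorem cocyc_mul_cocycInv {t t' : X ⟶ A ⊗ H} [IsComonHom t] [IsComonHom t'] (h : Indep t t') :
    cocyc b t t' * cocycInv b t t' = 1 := by
  unfold cocyc cocycInv
  rw [← Category.assoc t]
  exact hb.mul_lift_antipode (h.comp _ _)

theorem cocycInv_mul_cocyc {t t' : X ⟶ A ⊗ H} [IsComonHom t] [IsComonHom t'] (h : Indep t t') :
    cocycInv b t t' * cocyc b t t' = 1 := by
  unfold cocyc cocycInv
  rw [← Category.assoc t]
  exact hb.lift_antipode_mul (h.comp _ _)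

omit [IsCommComonObj H] in
theorem cocyc_mul_left {t t' s : X ⟶ A ⊗ H} [IsComonHom s] (h : Indep t t') (hs : Indep t s) :
    cocyc b (t * t') s = cocyc b t' s * cocyc b t s := by
  unfold cocyc
  rw [conv_mul_comp]
  exact hb.lift_mul_left (h.comp _ _) (hs.comp _ _)

omit [IsCommComonObj H] in
theorem cocyc_mul_right {t s s' : X ⟶ A ⊗ H} [IsComonHom t] (hs : Indep t s) :
    cocyc b t (s * s') = cocyc b t s * cocyc b t s' := by
  unfold cocyc
  rw [conv_mul_comp]
  exact hb.lift_mul_right (hs.comp _ _)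

-- Needed because a deformed product, placed in the second argument of the cocycle, brings its own
-- scalar factors with it.
omit [IsCommComonObj H] in
theorem cocyc_scal_right {t : X ⟶ A ⊗ H} [IsComonHom t] (a : X ⟶ 𝟙_ C) :
    cocyc b t (scal _ a) = a := by
  unfold cocyc
  rw [scal_comp]
  exact hb.lift_scal_right _ (by simp) a

-- The antipode reverses products and so does the pairing in its first variable; the two reversals
-- cancel.
omit [IsCommComonObj H] in
theorem cocycInv_mul_left {t t' s : X ⟶ A ⊗ H} [IsComonHom s] (h : Indep t t')
    (hs : Indep t' s) : cocycInv b (t * t') s = cocycInv b t s * cocycInv b t' s := by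
  unfold cocycInv
  have e : (t * t') ≫ snd A H ≫ 𝒮[H] = (t' ≫ snd A H ≫ 𝒮[H]) * (t ≫ snd A H ≫ 𝒮[H]) := by
    have hs : Indep ((t ≫ snd A H) ≫ 𝒮[H]) ((t' ≫ snd A H) ≫ 𝒮[H]) := (h.comp _ _).comp _ _
    unfold Indep at hs
    rw [← Category.assoc, conv_mul_comp, conv_mul_def, Category.assoc, HopfObj.mul_antipode,
      lift_map_assoc, ← Category.assoc (lift _ _), hs, conv_mul_def, Category.assoc,
      Category.assoc]
  rw [e]
  exact hb.lift_mul_left (h.comp _ _).symm (hs.comp _ _)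

theorem cocycInv_mul_right {t s s' : X ⟶ A ⊗ H} [IsComonHom t] (hs : Indep t s) :
    cocycInv b t (s * s') = cocycInv b t s * cocycInv b t s' := by
  unfold cocycInv
  rw [conv_mul_comp]
  exact hb.lift_mul_right (hs.comp _ _)

theorem cocycInv_scal_right {t : X ⟶ A ⊗ H} [IsComonHom t] (a : X ⟶ 𝟙_ C) :
    cocycInv b t (scal _ a) = a := by
  unfold cocycInv
  rw [scal_comp]
  exact hb.lift_scal_right _ (by simp) a

/-- On the `H`-component the cocycle commutes with the product by cocommutativity and cancels
against its inverse. Hence the first argument of the cocycle does not see the deformation. -/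
theorem lift_twistMul_snd {t t' : X ⟶ A ⊗ H} [IsComonHom t] [IsComonHom t'] (h : Indep t t') :
    (lift t t' ≫ twistMul b) ≫ snd A H = (t * t') ≫ snd A H := by
  have hc : Commute (scal H (cocyc b t t')) ((t * t') ≫ snd A H) := by
    refine Indep.commute_scal (Indep.cocyc ?_ ?_)
    · rw [conv_mul_comp]
      exact (Indep.mul_left (((indep_comp_snd t).comp_right _).symm) (h.symm.comp _ _)).symm
    · rw [conv_mul_comp]
      exact (Indep.mul_left (h.comp _ _) ((indep_comp_snd t').comp_right _)).symm
  rw [lift_twistMul h, conv_mul_comp, conv_mul_comp, scal_comp, scal_comp, hc.eq, mul_assoc,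
    ← scal_mul, cocyc_mul_cocycInv hb h, scal_one, mul_one]

/-- Two copies of the deformed product placed side by side contain `ω⁻¹ ω` in the middle. It
cancels, leaving the coproduct of the undeformed product between `ω` and `ω⁻¹`. -/
theorem isComonHom_twistMul : IsComonHom (twistMul b) where
  hom_counit := by
    have e : μ[A ⊗ H] ≫ ε[A ⊗ H] = 1 := by
      rw [BimonObj.mul_counit]; exact (Category.comp_id _).symm
    rw [twistMul, conv_mul_comp, conv_mul_comp, scal_comp, scal_comp, scal_unit, scal_unit, e,
      mul_one, cocyc_mul_cocycInv hb (indep_fst_snd _ _)]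
    exact Category.comp_id _
  hom_comul := by
    have := isComonHom_mulHom (A ⊗ H)
    have e : μ[A ⊗ H] ≫ Δ[A ⊗ H] = lift μ[A ⊗ H] μ[A ⊗ H] := IsComonHom.hom_comul _
    have e' : scal ((A ⊗ H) ⊗ (A ⊗ H)) (cocycInv b (fst (A ⊗ H) (A ⊗ H)) (snd _ _)) *
        scal _ (cocyc b (fst _ _) (snd _ _)) = 1 := by
      rw [← scal_mul, cocycInv_mul_cocyc hb (indep_fst_snd _ _), scal_one]
    change _ = lift (twistMul b) (twistMul b)
    rw [← comp_inl_mul_comp_inr, twistMul]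
    simp only [conv_mul_comp, scal_comp]
    rw [e, ← comp_inl_mul_comp_inr]
    simp only [mul_assoc]
    rw [← mul_assoc (scal _ (cocycInv _ _ _)) (scal _ (cocyc _ _ _)), e', one_mul]

omit [IsCommComonObj H] in
theorem cocyc_one_left (t : X ⟶ A ⊗ H) [IsComonHom t] : cocyc b 1 t = 1 := by
  unfold cocyc
  rw [conv_one_comp, hb.lift_one_left _ (by simp)]

omit [IsCommComonObj H] in
theorem cocyc_one_right (t : X ⟶ A ⊗ H) [IsComonHom t] : cocyc b t 1 = 1 := by
  unfold cocyc
  rw [conv_one_comp, hb.lift_one_right _ (by simp)]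

theorem lift_one_twistMul (t : X ⟶ A ⊗ H) [IsComonHom t] : lift 1 t ≫ twistMul b = t := by
  have h := cocyc_mul_cocycInv hb (indep_one_left (A := A ⊗ H) t)
  rw [cocyc_one_left hb, one_mul] at h
  rw [lift_twistMul (indep_one_left _), h, cocyc_one_left hb, scal_one]
  simp

theorem lift_twistMul_one (t : X ⟶ A ⊗ H) [IsComonHom t] : lift t 1 ≫ twistMul b = t := by
  have h := cocyc_mul_cocycInv hb (indep_one_right (A := A ⊗ H) t)
  rw [cocyc_one_right hb, one_mul] at h
  rw [lift_twistMul (indep_one_right _), h, cocyc_one_right hb, scal_one]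
  simp

theorem isComonHom_lift_twistMul {t t' : X ⟶ A ⊗ H} [IsComonHom t] [IsComonHom t']
    (h : Indep t t') : IsComonHom (lift t t' ≫ twistMul b) :=
  have := h.isComonHom_lift
  have := isComonHom_twistMul hb
  inferInstance

-- The monoid computation behind associativity. Here `x, y, z` are the three elements, `a, c, d` the
-- cocycles on the pairs (1,2), (1,3), (2,3), and primes denote their inverses.
omit hb in
theorem mul_twist_assoc {M : Type*} [Monoid M] {a a' c c' d d' x y z : M} (h₁ : Commute d x)
    (h₂ : Commute a' z) (h₃ : Commute a c) (h₄ : d' * d = 1) :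
    d * c * (a * (x * y) * a' * z) * (c' * d') =
      d * (a * c) * d' * (x * (d * (y * z) * d')) * (d * (a' * c') * d') := by
  have e₁ : ∀ w, a' * (z * w) = z * (a' * w) := fun w ↦ by rw [← mul_assoc, h₂.eq, mul_assoc]
  have e₂ : ∀ w, x * (d * w) = d * (x * w) := fun w ↦ by rw [← mul_assoc, ← h₁.eq, mul_assoc]
  have e₃ : ∀ w, a * (c * w) = c * (a * w) := fun w ↦ by rw [← mul_assoc, h₃.eq, mul_assoc]
  have e₄ : ∀ w, d' * (d * w) = w := fun w ↦ by rw [← mul_assoc, h₄, one_mul]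
  simp only [mul_assoc, e₁, e₂, e₃, e₄]

theorem lift_twistMul_assoc {t₁ t₂ t₃ : X ⟶ A ⊗ H} [IsComonHom t₁] [IsComonHom t₂]
    [IsComonHom t₃] (h₁₂ : Indep t₁ t₂) (h₁₃ : Indep t₁ t₃) (h₂₃ : Indep t₂ t₃) :
    lift (lift t₁ t₂ ≫ twistMul b) t₃ ≫ twistMul b =
      lift t₁ (lift t₂ t₃ ≫ twistMul b) ≫ twistMul b := by
  have i₁ := isComonHom_lift_twistMul hb h₁₂
  have i₂ := isComonHom_lift_twistMul hb h₂₃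
  have hl : Indep (lift t₁ t₂ ≫ twistMul b) t₃ := (h₁₃.lift_left h₂₃).comp_left _
  have hr : Indep t₁ (lift t₂ t₃ ≫ twistMul b) := (h₁₂.lift_right h₁₃).comp_right _
  have el : cocyc b (lift t₁ t₂ ≫ twistMul b) t₃ = cocyc b t₂ t₃ * cocyc b t₁ t₃ := by
    rw [← cocyc_mul_left hb h₁₂ h₁₃, cocyc, cocyc, lift_twistMul_snd hb h₁₂]
  have el' : cocycInv b (lift t₁ t₂ ≫ twistMul b) t₃ = cocycInv b t₁ t₃ * cocycInv b t₂ t₃ := by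
    rw [← cocycInv_mul_left hb h₁₂ h₂₃, cocycInv, cocycInv, ← Category.assoc, ← Category.assoc,
      lift_twistMul_snd hb h₁₂]
  have k₁ : Indep t₁ (scal (A ⊗ H) (cocyc b t₂ t₃)) :=
    (Indep.cocyc (h₁₂.symm.comp_left _) (h₁₃.symm.comp_left _)).symm.comp_right _
  have k₂ : Indep t₁ (scal (A ⊗ H) (cocyc b t₂ t₃) * (t₂ * t₃)) :=
    (Indep.mul_left k₁.symm (Indep.mul_left h₁₂.symm h₁₃.symm)).symm
  -- Unlike the first argument, the second one does see the deformation: the result is conjugated by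
  -- the cocycle of `t₂, t₃`.
  have er : cocyc b t₁ (lift t₂ t₃ ≫ twistMul b) =
      cocyc b t₂ t₃ * (cocyc b t₁ t₂ * cocyc b t₁ t₃) * cocycInv b t₂ t₃ := by
    rw [lift_twistMul h₂₃, cocyc_mul_right hb k₂, cocyc_mul_right hb k₁, cocyc_mul_right hb h₁₂,
      cocyc_scal_right hb, cocyc_scal_right hb]
  have er' : cocycInv b t₁ (lift t₂ t₃ ≫ twistMul b) =
      cocyc b t₂ t₃ * (cocycInv b t₁ t₂ * cocycInv b t₁ t₃) * cocycInv b t₂ t₃ := by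
    rw [lift_twistMul h₂₃, cocycInv_mul_right hb k₂, cocycInv_mul_right hb k₁,
      cocycInv_mul_right hb h₁₂, cocycInv_scal_right hb, cocycInv_scal_right hb]
  rw [lift_twistMul hl, lift_twistMul hr, el, el', er, er', lift_twistMul h₁₂, lift_twistMul h₂₃]
  simp only [scal_mul]
  refine mul_twist_assoc ?_ ?_ ?_ ?_
  · exact (Indep.cocyc (h₁₂.symm.comp_left _) (h₁₃.symm.comp_left _)).commute_scal
  · exact (Indep.cocycInv (h₁₃.comp_left _) (h₂₃.comp_left _)).commute_scal
  -- Both cocycles involve `t₁`, but only through its `H`-component, whose copies may be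
  -- interchanged.
  · exact (Indep.comp_right (Indep.cocyc
      (Indep.comp_right ((indep_comp_snd t₁).comp_right _ |>.lift_right (h₁₃.comp _ _)) b)
      ((h₁₂.symm.comp _ _).lift_right (h₂₃.comp _ _) |>.comp_right b)) _).commute_scal
  · rw [← scal_mul, cocycInv_mul_cocyc hb h₂₃, scal_one]

end

end Twist

/-! ### The brace identity and the deformed bimonoid. -/

section Brace

variable {C : Type u} [Category.{v} C] [MonoidalCategory C] [SymmetricCategory C]

variable {H A : C} [HopfObj H] [IsCommComonObj H] [HopfObj A]

/-- The monoid computation behind the brace identity: `c` passes `x`, after which `s * x` cancels.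
No commutation rule for `s` is required. -/
theorem mul_twist_compat {M : Type*} [Monoid M] {a a' c c' s x y z : M} (h₁ : Commute c x)
    (h₂ : Commute c y) (h₃ : Commute a' c) (h₄ : Commute a' z)
    (h₅ : s * x = 1) :
    a * c * (x * (y * z)) * (a' * c') = a * (x * y) * a' * (s * (c * (x * z) * c')) := by
  have e₁ : ∀ w, c * (x * w) = x * (c * w) := fun w ↦ by rw [← mul_assoc, h₁.eq, mul_assoc]
  have e₂ : ∀ w, c * (y * w) = y * (c * w) := fun w ↦ by rw [← mul_assoc, h₂.eq, mul_assoc]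
  have e₃ : ∀ w, a' * (c * w) = c * (a' * w) := fun w ↦ by rw [← mul_assoc, h₃.eq, mul_assoc]
  have e₄ : ∀ w, a' * (z * w) = z * (a' * w) := fun w ↦ by rw [← mul_assoc, h₄.eq, mul_assoc]
  have e₅ : ∀ w, s * (x * w) = w := fun w ↦ by rw [← mul_assoc, h₅, one_mul]
  simp only [mul_assoc, e₁, e₂, e₃, e₄, e₅]

section

variable {X : C} [ComonObj X] {b : H ⊗ A ⟶ 𝟙_ C} (hb : IsSkewPairing b)

include hb

theorem lift_mul_twistMul {t₁ t₂ t₃ : X ⟶ A ⊗ H} [IsComonHom t₁] [IsComonHom t₂]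
    [IsComonHom t₃] (h₁₂ : Indep t₁ t₂) (h₁₃ : Indep t₁ t₃) (h₂₃ : Indep t₂ t₃) :
    lift t₁ (t₂ * t₃) ≫ twistMul b =
      (lift t₁ t₂ ≫ twistMul b) * ((t₁ ≫ 𝒮[A ⊗ H]) * (lift t₁ t₃ ≫ twistMul b)) := by
  have := h₂₃.isComonHom_mul
  rw [lift_twistMul (Indep.mul_left h₁₂.symm h₁₃.symm).symm, lift_twistMul h₁₂, lift_twistMul h₁₃,
    cocyc_mul_right hb h₁₂, cocycInv_mul_right hb h₁₂]
  simp only [scal_mul]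
  have h₁₁ : Indep (t₁ ≫ snd A H) (t₁ ≫ snd A H) := (indep_comp_snd t₁).comp_right _
  have k : Indep (cocycInv b t₁ t₂) (t₁ ≫ snd A H) :=
    Indep.cocycInv h₁₁ (h₁₂.symm.comp _ _)
  have k' : Indep (cocycInv b t₁ t₂) t₃ := Indep.cocycInv (h₁₃.comp_left _) (h₂₃.comp_left _)
  refine mul_twist_compat ?_ ?_ ?_ ?_ (comp_antipode_mul t₁)
  -- The decisive use of cocommutativity: the cocycle of `t₁, t₃` commutes with `t₁` itself, so the
  -- antipode of `t₁` can meet `t₁`.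
  · exact (Indep.cocyc (indep_comp_snd t₁) (h₁₃.symm.comp_left _)).commute_scal
  · exact (Indep.cocyc (h₁₂.comp_left _) (h₂₃.symm.comp_left _)).commute_scal
  · exact (((k.lift_right (k'.comp_right _)).comp_right b).comp_right _).commute_scal
  · exact k'.commute_scal

theorem twistMul_compat :
    (A ⊗ H) ◁ μ[A ⊗ H] ≫ twistMul b =
      Δ[A ⊗ H] ▷ ((A ⊗ H) ⊗ (A ⊗ H)) ≫ tensorμ (A ⊗ H) (A ⊗ H) (A ⊗ H) (A ⊗ H) ≫
        (twistMul b ⊗ₘ (Δ[A ⊗ H] ▷ (A ⊗ H) ≫ (α_ _ _ _).hom ≫ (𝒮[A ⊗ H] ⊗ₘ twistMul b) ≫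
          μ[A ⊗ H])) ≫ μ[A ⊗ H] := by
  set T := A ⊗ H
  let t₁ := fst T (T ⊗ T)
  let t₂ := snd T (T ⊗ T) ≫ fst T T
  let t₃ := snd T (T ⊗ T) ≫ snd T T
  have h₁₂ : Indep t₁ t₂ := (indep_fst_snd _ _).comp_right _
  have h₁₃ : Indep t₁ t₃ := (indep_fst_snd _ _).comp_right _
  have h₂₃ : Indep t₂ t₃ := (indep_fst_snd _ _).precomp _
  -- The three projections form the generic triple; inserting this identity reduces the claim to
  -- `lift_mul_twistMul`.
  have hid : lift t₁ (lift t₂ t₃) = 𝟙 _ := by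
    rw [← comp_lift, lift_fst_snd, Category.comp_id, lift_fst_snd]
  have hΔ : t₁ ≫ Δ[T] = lift t₁ t₁ := IsComonHom.hom_comul t₁
  have main := lift_mul_twistMul hb h₁₂ h₁₃ h₂₃
  rw [← Category.id_comp (T ◁ μ[T] ≫ _), ← Category.id_comp (Δ[T] ▷ _ ≫ _), ← hid,
    lift_whiskerLeft_assoc, lift_whiskerRight_assoc, hΔ, lift_tensorμ_assoc _ _ _ _ h₁₂,
    lift_map_assoc, lift_whiskerRight_assoc, hΔ, lift_assoc_assoc, lift_map_assoc]
  exact main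

end

/-- The object `A ⊗ H` with the product deformed by the two-cocycle given by a pairing. -/
def Dbl {b : H ⊗ A ⟶ 𝟙_ C} (_ : IsSkewPairing b) : C := A ⊗ H

section

variable {b : H ⊗ A ⟶ 𝟙_ C} (hb : IsSkewPairing b)

instance : ComonObj (Dbl hb) := inferInstanceAs (ComonObj (A ⊗ H))

instance : MonObj (Dbl hb) where
  one := η[A ⊗ H]
  mul := twistMul b
  one_mul := by
    have h := lift_one_twistMul hb (𝟙 (A ⊗ H))
    rw [conv_one_def, ← lift_whiskerRight_assoc, lift_counit_left_assoc, Category.id_comp] at h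
    exact ((Iso.inv_comp_eq _).1 h).trans (Category.comp_id _)
  mul_one := by
    have h := lift_twistMul_one hb (𝟙 (A ⊗ H))
    rw [conv_one_def, ← lift_whiskerLeft_assoc, lift_counit_right_assoc, Category.id_comp] at h
    exact ((Iso.inv_comp_eq _).1 h).trans (Category.comp_id _)
  mul_assoc := by
    change twistMul b ▷ (A ⊗ H) ≫ twistMul b =
      (α_ (A ⊗ H) (A ⊗ H) (A ⊗ H)).hom ≫ (A ⊗ H) ◁ twistMul b ≫ twistMul b
    set T := A ⊗ H
    let t₁ := fst (T ⊗ T) T ≫ fst T T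
    let t₂ := fst (T ⊗ T) T ≫ snd T T
    let t₃ := snd (T ⊗ T) T
    have h₁₂ : Indep t₁ t₂ := (indep_fst_snd _ _).precomp _
    have h₁₃ : Indep t₁ t₃ := (indep_fst_snd _ _).comp_left _
    have h₂₃ : Indep t₂ t₃ := (indep_fst_snd _ _).comp_left _
    have hid : lift (lift t₁ t₂) t₃ = 𝟙 _ := by
      rw [← comp_lift, lift_fst_snd, Category.comp_id, lift_fst_snd]
    rw [← Category.id_comp (twistMul b ▷ _ ≫ _), ← Category.id_comp ((α_ _ _ _).hom ≫ _), ← hid,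
      lift_assoc_assoc, lift_whiskerLeft_assoc, lift_whiskerRight_assoc]
    exact lift_twistMul_assoc hb h₁₂ h₁₃ h₂₃

instance : BimonObj (Dbl hb) where
  toMonObj := inferInstance
  toComonObj := inferInstance
  mul_comul := by
    have h := (isComonHom_twistMul hb).hom_comul
    rw [Comon.tensorObj_comul (A ⊗ H), Category.assoc] at h
    exact h
  one_comul := BimonObj.one_comul (A ⊗ H)
  mul_counit := (isComonHom_twistMul hb).hom_counit
  one_counit := BimonObj.one_counit (A ⊗ H)

end

end Brace

/-! ### The antipode of the deformed algebra. -/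

section DoubleAntipode

variable {C : Type u} [Category.{v} C] [MonoidalCategory C] [SymmetricCategory C]

section

variable {H A X : C} [HopfObj H] [HopfObj A] [ComonObj X]

theorem inl_fst : inl A H ≫ fst A H = 𝟙 A := by
  rw [← Category.id_comp (inl A H), comp_inl, lift_fst _ _ (by simp)]

theorem inl_snd : inl A H ≫ snd A H = 1 := by
  rw [← Category.id_comp (inl A H), comp_inl, lift_snd _ _ (by simp)]

theorem inr_fst : inr A H ≫ fst A H = 1 := by
  rw [← Category.id_comp (inr A H), comp_inr, lift_fst _ _ (by simp)]

theorem inr_snd : inr A H ≫ snd A H = 𝟙 H := by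
  rw [← Category.id_comp (inr A H), comp_inr, lift_snd _ _ (by simp)]

instance isComonHom_inl : IsComonHom (inl A H) := by
  rw [← Category.id_comp (inl A H), comp_inl]
  exact (indep_one_right _).isComonHom_lift

instance isComonHom_inr : IsComonHom (inr A H) := by
  rw [← Category.id_comp (inr A H), comp_inr]
  exact (indep_one_left _).isComonHom_lift

/-- Precomposition with an anticomultiplicative morphism reverses products with scalars. -/
theorem comp_scal_mul_scal {W B : C} [ComonObj W] [MonObj B] {s : W ⟶ X}
    (hs : s ≫ Δ[X] = Δ[W] ≫ (β_ W W).hom ≫ (s ⊗ₘ s)) (a c : X ⟶ 𝟙_ C) (f : X ⟶ B) :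
    s ≫ (scal B a * f * scal B c) = scal B (s ≫ c) * (s ≫ f) * scal B (s ≫ a) := by
  have h : ∀ {Y Z : C} (p : X ⟶ Y) (q : X ⟶ Z),
      s ≫ lift p q = lift (s ≫ q) (s ≫ p) ≫ (β_ Z Y).hom := by
    intro Y Z p q
    rw [lift, reassoc_of% hs, lift, Category.assoc, BraidedCategory.braiding_naturality]
    simp
  have hl : ∀ (a : X ⟶ 𝟙_ C) (f : X ⟶ B), s ≫ (scal B a * f) = (s ≫ f) * scal B (s ≫ a) := by
    intro a f
    rw [scal_mul_eq_lift, mul_scal_eq_lift, ← Category.assoc, h]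
    simp
  have hr : ∀ (a : X ⟶ 𝟙_ C) (f : X ⟶ B), s ≫ (f * scal B a) = scal B (s ≫ a) * (s ≫ f) := by
    intro a f
    rw [scal_mul_eq_lift, mul_scal_eq_lift, ← Category.assoc, h]
    simp
  rw [hr, hl, mul_assoc]

theorem antipode_tensor : 𝒮[A ⊗ H] = 𝒮[A] ⊗ₘ 𝒮[H] := rfl

theorem lift_snd_fst : lift (snd A H) (fst A H) = (β_ A H).hom := by
  rw [← indep_fst_snd, lift_fst_snd, Category.id_comp]

theorem antipode_lift_snd_fst {Y Z : C} (p : H ⟶ Y) (q : A ⟶ Z) :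
    𝒮[A ⊗ H] ≫ lift (snd A H ≫ p) (fst A H ≫ q) =
      lift (snd A H ≫ 𝒮[H] ≫ p) (fst A H ≫ 𝒮[A] ≫ q) := by
  rw [← lift_map, ← lift_map, lift_snd_fst, antipode_tensor,
    BraidedCategory.braiding_naturality_assoc, tensorHom_comp_tensorHom]

end

variable {H A X : C} [HopfObj H] [IsCommComonObj H] [HopfObj A] [ComonObj X]
  {b : H ⊗ A ⟶ 𝟙_ C}

section

variable (hb : IsSkewPairing b)

include hb

/-- The cocycle reads only the `H`-component of its left argument, so it is trivial here, and then
so is its inverse. -/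
theorem lift_twistMul_of_left {t t' : X ⟶ A ⊗ H} [IsComonHom t] [IsComonHom t']
    (h : Indep t t') (ht : t ≫ snd A H = 1) : lift t t' ≫ twistMul b = t * t' := by
  have e : cocyc b t t' = 1 := by rw [cocyc, ht, hb.lift_one_left _ (by simp)]
  have e' := cocyc_mul_cocycInv hb h
  rw [e, one_mul] at e'
  rw [lift_twistMul h, e, e', scal_one, mul_one, one_mul]

theorem lift_twistMul_of_right {t t' : X ⟶ A ⊗ H} [IsComonHom t] [IsComonHom t']
    (h : Indep t t') (ht : t' ≫ fst A H = 1) : lift t t' ≫ twistMul b = t * t' := by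
  have e : cocyc b t t' = 1 := by rw [cocyc, ht, hb.lift_one_right _ (by simp)]
  have e' := cocyc_mul_cocycInv hb h
  rw [e, one_mul] at e'
  rw [lift_twistMul h, e, e', scal_one, mul_one, one_mul]

end

/-- The antipode of `A ⊗ H` deformed by the two-cocycle given by `b`. -/
def twistAntipode (b : H ⊗ A ⟶ 𝟙_ C) : A ⊗ H ⟶ A ⊗ H :=
  scal _ (lift (snd A H) (fst A H ≫ 𝒮[A]) ≫ b) * 𝒮[A ⊗ H] * scal _ (lift (snd A H) (fst A H) ≫ b)

variable (hb : IsSkewPairing b)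

-- Apply the antipode of `A ⊗ H` to the deformed product of the `H`-part with the `A`-part. Their
-- undeformed product is the identity, and anticomultiplicativity exchanges the scalars `ω` and
-- `ω⁻¹`. Since `𝒮[H]` is an involution, these become the two scalars of `twistAntipode`.
include hb in
theorem twistAntipode_eq : twistAntipode b =
    lift (snd A H ≫ 𝒮[H] ≫ inr A H) (fst A H ≫ 𝒮[A] ≫ inl A H) ≫ twistMul b := by
  have hi : Indep (snd A H ≫ inr A H) (fst A H ≫ inl A H) := (indep_fst_snd A H).symm.comp _ _
  have e : (snd A H ≫ inr A H) * (fst A H ≫ inl A H) = 𝟙 (A ⊗ H) := by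
    rw [comp_inl, comp_inr, lift_mul_lift (indep_fst_snd A H).symm, one_mul, mul_one,
      lift_fst_snd]
  have h₁ := antipode_lift_snd_fst (A := A) (H := H) (𝟙 H) (𝟙 A)
  have h₂ := antipode_lift_snd_fst (A := A) (H := H) 𝒮[H] (𝟙 A)
  simp only [Category.comp_id, antipode_antipode_of_comm] at h₁ h₂
  have h₃ := hb.lift_comp_antipode (v := snd A H ≫ 𝒮[H]) (u := fst A H)
    ((indep_fst_snd A H).symm.comp_left _)
  simp only [Category.assoc, antipode_antipode_of_comm, Category.comp_id] at h₃
  rw [← antipode_lift_snd_fst, Category.assoc, lift_twistMul hi, e,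
    comp_scal_mul_scal (HopfObj.antipode_comul (A ⊗ H)), cocyc, cocycInv]
  simp only [Category.assoc, inl_fst, reassoc_of% (inr_snd (A := A) (H := H)), inr_snd,
    Category.comp_id]
  rw [reassoc_of% h₁, reassoc_of% h₂, h₃]
  rfl

/-- The embedding of `A` into the double. -/
def dblInl : A ⟶ Dbl hb := inl A H

/-- The embedding of `H` into the double. -/
def dblInr : H ⟶ Dbl hb := inr A H

instance isMonHom_dblInl : IsMonHom (dblInl hb) where
  one_hom := IsMonHom.one_hom (inl A H)
  mul_hom := by
    change μ[A] ≫ inl A H = (inl A H ⊗ₘ inl A H) ≫ twistMul b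
    have h : lift (fst A A ≫ inl A H) (snd A A ≫ inl A H) ≫ twistMul b = _ :=
      lift_twistMul_of_left hb ((indep_fst_snd A A).comp _ _)
        (by rw [Category.assoc, inl_snd, comp_conv_one])
    rw [← conv_mul_comp, mulHom_eq, ← lift_map, lift_fst_snd, Category.id_comp] at h
    exact h.symm

instance isMonHom_dblInr : IsMonHom (dblInr hb) where
  one_hom := IsMonHom.one_hom (inr A H)
  mul_hom := by
    change μ[H] ≫ inr A H = (inr A H ⊗ₘ inr A H) ≫ twistMul b
    have h : lift (fst H H ≫ inr A H) (snd H H ≫ inr A H) ≫ twistMul b = _ :=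
      lift_twistMul_of_right hb ((indep_fst_snd H H).comp _ _)
        (by rw [Category.assoc, inr_fst, comp_conv_one])
    rw [← conv_mul_comp, mulHom_eq, ← lift_map, lift_fst_snd, Category.id_comp] at h
    exact h.symm

theorem dbl_id_eq : (fst A H ≫ dblInl hb) * (snd A H ≫ dblInr hb) =
    (𝟙 (A ⊗ H) : A ⊗ H ⟶ Dbl hb) := by
  have h : lift (fst A H ≫ inl A H) (snd A H ≫ inr A H) ≫ twistMul b = _ :=
    lift_twistMul_of_left hb ((indep_fst_snd A H).comp _ _)
      (by rw [Category.assoc, inl_snd, comp_conv_one])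
  rw [comp_inl_mul_comp_inr, lift_fst_snd] at h
  exact h

theorem dbl_antipode_eq :
    (snd A H ≫ 𝒮[H] ≫ dblInr hb) * (fst A H ≫ 𝒮[A] ≫ dblInl hb) =
      (twistAntipode b : A ⊗ H ⟶ Dbl hb) :=
  (twistAntipode_eq hb).symm

/-- `A` and `H` embed as subalgebras of the deformed algebra, so with the identity factored as
`A`-part times `H`-part the product telescopes, using only their own antipodes. -/
theorem dbl_antipode_mul_id :
    ((snd A H ≫ 𝒮[H] ≫ dblInr hb) * (fst A H ≫ 𝒮[A] ≫ dblInl hb)) *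
      ((fst A H ≫ dblInl hb) * (snd A H ≫ dblInr hb)) = 1 := by
  have h₁ : (fst A H ≫ 𝒮[A] ≫ dblInl hb) * (fst A H ≫ dblInl hb) = 1 := by
    rw [← Category.assoc, ← conv_mul_comp, comp_antipode_mul, conv_one_comp]
  have h₂ : (snd A H ≫ 𝒮[H] ≫ dblInr hb) * (snd A H ≫ dblInr hb) = 1 := by
    rw [← Category.assoc, ← conv_mul_comp, comp_antipode_mul, conv_one_comp]
  rw [mul_assoc, ← mul_assoc (fst A H ≫ 𝒮[A] ≫ dblInl hb), h₁, one_mul, h₂]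

theorem dbl_id_mul_antipode :
    ((fst A H ≫ dblInl hb) * (snd A H ≫ dblInr hb)) *
      ((snd A H ≫ 𝒮[H] ≫ dblInr hb) * (fst A H ≫ 𝒮[A] ≫ dblInl hb)) = 1 := by
  have h₁ : (fst A H ≫ dblInl hb) * (fst A H ≫ 𝒮[A] ≫ dblInl hb) = 1 := by
    rw [← Category.assoc (fst A H) 𝒮[A], ← conv_mul_comp, mul_comp_antipode, conv_one_comp]
  have h₂ : (snd A H ≫ dblInr hb) * (snd A H ≫ 𝒮[H] ≫ dblInr hb) = 1 := by
    rw [← Category.assoc (snd A H) 𝒮[H], ← conv_mul_comp, mul_comp_antipode, conv_one_comp]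
  rw [mul_assoc, ← mul_assoc (snd A H ≫ dblInr hb), h₂, one_mul, h₁]

instance hopfObjDbl : HopfObj (Dbl hb) where
  antipode := twistAntipode b
  antipode_left := by
    have h : lift (twistAntipode b) (𝟙 (A ⊗ H)) ≫ twistMul b = ε[A ⊗ H] ≫ η[A ⊗ H] := by
      have h := dbl_antipode_mul_id hb
      rw [dbl_antipode_eq, dbl_id_eq] at h
      exact h
    rw [lift, tensorHom_id, Category.assoc] at h
    exact h
  antipode_right := by
    have h : lift (𝟙 (A ⊗ H)) (twistAntipode b) ≫ twistMul b = ε[A ⊗ H] ≫ η[A ⊗ H] := by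
      have h := dbl_id_mul_antipode hb
      rw [dbl_antipode_eq, dbl_id_eq] at h
      exact h
    rw [lift, id_tensorHom, Category.assoc] at h
    exact h

end DoubleAntipode

/-! ### Transposition along a duality and the dual comonoid. -/

section Dual

variable {C : Type u} [Category.{v} C] [MonoidalCategory C]

section Pairing

variable {X Y Z W : C} [ExactPairing Y X]

/-- Nondegeneracy of the evaluation: the zigzag identity recovers `f` from its transpose. -/
theorem ev_injective {f g : W ⟶ Y} (h : X ◁ f ≫ ε_ Y X = X ◁ g ≫ ε_ Y X) : f = g := by
  have key : ∀ f : W ⟶ Y, f = (λ_ W).inv ≫ η_ Y X ▷ W ≫ (α_ Y X W).hom ≫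
      Y ◁ (X ◁ f ≫ ε_ Y X) ≫ (ρ_ Y).hom := by
    intro f
    have e : (α_ Y X W).hom ≫ Y ◁ X ◁ f = (Y ⊗ X) ◁ f ≫ (α_ Y X Y).hom := by simp
    rw [whiskerLeft_comp, Category.assoc, reassoc_of% e, ← whisker_exchange_assoc,
      ExactPairing.evaluation_coevaluation_assoc]
    simp
  rw [key f, key g, h]

theorem lift_ev_injective {f g : W ⟶ Y ⊗ Z}
    (h : X ◁ f ≫ (α_ _ _ _).inv ≫ ε_ Y X ▷ Z ≫ (λ_ Z).hom =
      X ◁ g ≫ (α_ _ _ _).inv ≫ ε_ Y X ▷ Z ≫ (λ_ Z).hom) : f = g :=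
  (tensorLeftHomEquiv W Y X Z).symm.injective h

theorem whiskerLeft_comp_ev {Z' : C} (f : W ⟶ Y ⊗ Z) (k : Z ⟶ Z') :
    X ◁ (f ≫ Y ◁ k) ≫ (α_ X Y Z').inv ≫ ε_ Y X ▷ Z' ≫ (λ_ Z').hom =
      (X ◁ f ≫ (α_ X Y Z).inv ≫ ε_ Y X ▷ Z ≫ (λ_ Z).hom) ≫ k := by
  have e : X ◁ Y ◁ k ≫ (α_ X Y Z').inv = (α_ X Y Z).inv ≫ (X ⊗ Y) ◁ k := by simp
  rw [whiskerLeft_comp, Category.assoc, reassoc_of% e, whisker_exchange_assoc]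
  simp

theorem whiskerLeft_coev_ev (g : X ⊗ W ⟶ Z) :
    X ◁ ((λ_ W).inv ≫ η_ Y X ▷ W ≫ (α_ Y X W).hom ≫ Y ◁ g) ≫ (α_ _ _ _).inv ≫
      ε_ Y X ▷ Z ≫ (λ_ Z).hom = g :=
  (tensorLeftHomEquiv W Y X Z).left_inv g

theorem whiskerLeft_coev_ev_unit (g : X ⊗ W ⟶ 𝟙_ C) :
    X ◁ ((λ_ W).inv ≫ η_ Y X ▷ W ≫ (α_ Y X W).hom ≫ Y ◁ g ≫ (ρ_ Y).hom) ≫ ε_ Y X = g := by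
  conv_rhs => rw [← whiskerLeft_coev_ev (Y := Y) g]
  monoidal

end Pairing

namespace HopfData

variable {X : C} (B : HopfData X) (Y : C) [ExactPairing Y X]

/-- The action of `X` on its dual for which `f₁(x) f₂ = x ⇀ f`. -/
def dualAct : X ⊗ Y ⟶ Y :=
  (λ_ (X ⊗ Y)).inv ≫ η_ Y X ▷ (X ⊗ Y) ≫ (α_ Y X (X ⊗ Y)).hom ≫
    Y ◁ ((α_ X X Y).inv ≫ B.mul ▷ Y ≫ ε_ Y X) ≫ (ρ_ Y).hom

theorem dual_comul_eq : (B.dual Y).comul =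
    (λ_ Y).inv ≫ η_ Y X ▷ Y ≫ (α_ Y X Y).hom ≫ Y ◁ B.dualAct Y := by
  simp only [dual, dualAct]
  monoidal

theorem dual_mul_eq : (B.dual Y).mul =
    (λ_ (Y ⊗ Y)).inv ≫ η_ Y X ▷ (Y ⊗ Y) ≫ (α_ Y X (Y ⊗ Y)).hom ≫
      Y ◁ (B.comul ▷ (Y ⊗ Y) ≫ (α_ X X (Y ⊗ Y)).hom ≫ X ◁ ((α_ X Y Y).inv ≫ ε_ Y X ▷ Y ≫
        (λ_ Y).hom) ≫ ε_ Y X) ≫ (ρ_ Y).hom := by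
  simp only [dual]
  monoidal

theorem dual_one_eq : (B.dual Y).one =
    (λ_ (𝟙_ C)).inv ≫ η_ Y X ▷ (𝟙_ C) ≫ (α_ Y X (𝟙_ C)).hom ≫
      Y ◁ ((ρ_ X).hom ≫ B.counit) ≫ (ρ_ Y).hom := by
  simp only [dual]
  monoidal

theorem dual_antipode_eq : (B.dual Y).antipode =
    (λ_ Y).inv ≫ η_ Y X ▷ Y ≫ (α_ Y X Y).hom ≫ Y ◁ (B.antipode ▷ Y ≫ ε_ Y X) ≫ (ρ_ Y).hom := by
  simp only [dual]
  monoidal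

theorem dual_one_ev : X ◁ (B.dual Y).one ≫ ε_ Y X = (ρ_ X).hom ≫ B.counit := by
  rw [dual_one_eq, whiskerLeft_coev_ev_unit]

theorem dual_antipode_ev : X ◁ (B.dual Y).antipode ≫ ε_ Y X = B.antipode ▷ Y ≫ ε_ Y X := by
  rw [dual_antipode_eq, whiskerLeft_coev_ev_unit]

theorem dual_mul_ev : X ◁ (B.dual Y).mul ≫ ε_ Y X =
    B.comul ▷ (Y ⊗ Y) ≫ (α_ X X (Y ⊗ Y)).hom ≫ X ◁ ((α_ X Y Y).inv ≫ ε_ Y X ▷ Y ≫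
        (λ_ Y).hom) ≫ ε_ Y X := by
  rw [dual_mul_eq, whiskerLeft_coev_ev_unit]

theorem dual_comul_ev : X ◁ (B.dual Y).comul ≫ (α_ _ _ _).inv ≫ ε_ Y X ▷ Y ≫ (λ_ Y).hom =
    B.dualAct Y := by
  rw [dual_comul_eq, whiskerLeft_coev_ev]

theorem dualAct_ev : X ◁ B.dualAct Y ≫ ε_ Y X = (α_ X X Y).inv ≫ B.mul ▷ Y ≫ ε_ Y X := by
  rw [dualAct, whiskerLeft_coev_ev_unit]

end HopfData

section

variable [BraidedCategory C] (X Y : C) [HopfObj X] [ExactPairing Y X] (B : HopfData X)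
  (hone : B.one = η[X]) (hmul : B.mul = μ[X])

include hmul

/-- With `mul_dualAct` these are the module axioms, transposes of the right unit law and
associativity of `X`. They yield one counit law and coassociativity of the dual; the other counit
law is `counit_dualAct`. -/
theorem one_dualAct : (λ_ Y).inv ≫ η[X] ▷ Y ≫ B.dualAct Y = 𝟙 Y := by
  refine ev_injective (X := X) ?_
  have e : X ◁ η[X] ▷ Y ≫ (α_ X X Y).inv = (α_ X (𝟙_ C) Y).inv ≫ (X ◁ η[X]) ▷ Y := by simp
  simp only [whiskerLeft_comp, Category.assoc, B.dualAct_ev, hmul]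
  rw [reassoc_of% e, ← comp_whiskerRight_assoc, MonObj.mul_one]
  monoidal

theorem mul_dualAct : X ◁ B.dualAct Y ≫ B.dualAct Y = (α_ X X Y).inv ≫ μ[X] ▷ Y ≫ B.dualAct Y := by
  refine ev_injective (X := X) ?_
  have e₁ : X ◁ X ◁ B.dualAct Y ≫ (α_ X X Y).inv =
    (α_ X X (X ⊗ Y)).inv ≫ (X ⊗ X) ◁ B.dualAct Y := by simp
  have e₂ : X ◁ μ[X] ▷ Y ≫ (α_ X X Y).inv = (α_ X (X ⊗ X) Y).inv ≫ (X ◁ μ[X]) ▷ Y := by simp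
  simp only [whiskerLeft_comp, Category.assoc, B.dualAct_ev, hmul]
  rw [reassoc_of% e₁, reassoc_of% e₂, whisker_exchange_assoc, B.dualAct_ev, hmul,
    ← comp_whiskerRight_assoc, MonObj.mul_assoc_flip]
  monoidal

include hone

theorem counit_dualAct : B.dualAct Y ≫ (B.dual Y).counit = ε_ Y X := by
  have e : B.dualAct Y ≫ (B.dual Y).counit =
      (λ_ (X ⊗ Y)).inv ≫ η[X] ▷ (X ⊗ Y) ≫ X ◁ B.dualAct Y ≫ ε_ Y X := by
    simp only [HopfData.dual, hone]
    rw [← whisker_exchange_assoc]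
    simp
  have e' : η[X] ▷ (X ⊗ Y) ≫ (α_ X X Y).inv = (α_ _ X Y).inv ≫ (η[X] ▷ X) ▷ Y := by simp
  rw [e, B.dualAct_ev, reassoc_of% e', hmul, ← comp_whiskerRight_assoc, MonObj.one_mul]
  monoidal

/-- The comonoid structure on the dual. -/
abbrev dualComonObj : ComonObj Y where
  counit := (B.dual Y).counit
  comul := (B.dual Y).comul
  counit_comul := by
    have h : (B.dual Y).comul ≫ (B.dual Y).counit ▷ Y = ((λ_ Y).inv ≫ η[X] ▷ Y ≫
        X ◁ (B.dual Y).comul ≫ (α_ _ _ _).inv ≫ ε_ Y X ▷ Y ≫ (λ_ Y).hom) ≫ (λ_ Y).inv := by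
      simp only [HopfData.dual, hone]
      rw [← whisker_exchange_assoc]
      monoidal
    rw [h, B.dual_comul_ev, one_dualAct X Y B hmul, Category.id_comp]
  comul_counit := by
    refine lift_ev_injective (X := X) ?_
    rw [whiskerLeft_comp_ev, B.dual_comul_ev, counit_dualAct X Y B hone hmul]
    monoidal
  comul_assoc := by
    -- Pairing the first two tensor factors with two elements of `X` amounts to pairing the first
    -- factor of `f` with their product.
    have h : ∀ {W Z : C} (f : W ⟶ Y ⊗ Z), X ◁ (X ◁ (f ≫ (B.dual Y).comul ▷ Z ≫ (α_ Y Y Z).hom) ≫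
        (α_ _ _ _).inv ≫ ε_ Y X ▷ _ ≫ (λ_ _).hom) ≫ (α_ _ _ _).inv ≫ ε_ Y X ▷ _ ≫ (λ_ _).hom =
        (α_ X X W).inv ≫ μ[X] ▷ W ≫ X ◁ f ≫ (α_ _ _ _).inv ≫ ε_ Y X ▷ _ ≫ (λ_ _).hom := by
      intro W Z f
      have e : X ◁ (f ≫ (B.dual Y).comul ▷ Z ≫ (α_ Y Y Z).hom) ≫
          (α_ _ _ _).inv ≫ ε_ Y X ▷ _ ≫ (λ_ _).hom = X ◁ f ≫ (α_ X Y Z).inv ≫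
          (X ◁ (B.dual Y).comul ≫ (α_ _ _ _).inv ≫ ε_ Y X ▷ Y ≫ (λ_ Y).hom) ▷ Z := by
        monoidal
      have e' : X ◁ (X ◁ f ≫ (α_ X Y Z).inv ≫ B.dualAct Y ▷ Z) ≫ (α_ _ _ _).inv ≫
          ε_ Y X ▷ _ ≫ (λ_ _).hom = (α_ X X W).inv ≫ (X ⊗ X) ◁ f ≫ (α_ X X (Y ⊗ Z)).hom ≫
          X ◁ (α_ X Y Z).inv ≫ (α_ _ _ _).inv ≫
            (X ◁ B.dualAct Y ≫ ε_ Y X) ▷ Z ≫ (λ_ Z).hom := by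
        monoidal
      rw [e, B.dual_comul_ev, e', B.dualAct_ev, hmul, ← whisker_exchange_assoc]
      monoidal
    refine lift_ev_injective (X := X) (lift_ev_injective (X := X) ?_)
    rw [h, whiskerLeft_comp_ev, B.dual_comul_ev, whiskerLeft_comp, Category.assoc,
      B.dual_comul_ev, mul_dualAct X Y B hmul]

end

end Dual

/-! ### The Hopf algebra dual to `H^cop` and its evaluation pairing. -/

section DualHopf

variable {C : Type u} [Category.{v} C] [MonoidalCategory C]

theorem lift_lift_unit [BraidedCategory C] {X Y Z : C} [ComonObj X] {f : X ⟶ Y} {a : X ⟶ 𝟙_ C}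
    (g : X ⟶ Z) (h : Indep f a) :
    lift f (lift a g ≫ (λ_ Z).hom) = lift a (lift f g) ≫ (λ_ (Y ⊗ Z)).hom := by
  unfold Indep at h
  have e : lift f a ≫ (ρ_ Y).hom = lift a f ≫ (λ_ Y).hom := by
    rw [← h, Category.assoc, braiding_tensorUnit_right]; simp
  rw [← lift_whiskerLeft, ← lift_assoc, Category.assoc, triangle, lift_whiskerRight, e,
    ← lift_whiskerRight, ← lift_assoc, Category.assoc, leftUnitor_tensor_hom,
    Iso.hom_inv_id_assoc]

theorem lift_lift_unit_assoc [BraidedCategory C] {X Y Z V : C} [ComonObj X] {f : X ⟶ Y}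
    {a : X ⟶ 𝟙_ C} (g : X ⟶ Z) (h : Indep f a) (l : Y ⊗ Z ⟶ V) :
    lift f (lift a g ≫ (λ_ Z).hom) ≫ l = lift a (lift f g) ≫ (λ_ (Y ⊗ Z)).hom ≫ l := by
  rw [← Category.assoc, lift_lift_unit g h, Category.assoc]

theorem lift_lift_ev [BraidedCategory C] {X H A : C} [ComonObj X] {y : X ⟶ H} {a : X ⟶ 𝟙_ C}
    (g : X ⟶ A) (h : Indep y a) (b : H ⊗ A ⟶ 𝟙_ C) :
    lift y (lift a g ≫ (λ_ A).hom) ≫ b = a * (lift y g ≫ b) := by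
  rw [lift_lift_unit_assoc g h, conv_unit_mul_def, ← leftUnitor_naturality,
    lift_whiskerLeft_assoc]

variable [SymmetricCategory C] (H Hd : C) [HopfObj H] [IsCommComonObj H] [ExactPairing Hd H]

/-- The object `Hd`, regarded as the carrier of the Hopf algebra dual to `H^cop`. -/
def DualObj (_H Hd : C) : C := Hd

instance : ExactPairing (DualObj H Hd) H := inferInstanceAs (ExactPairing Hd H)

/-- The comonoid underlying `(H^cop)^*`. -/
instance dualCopComonObj : ComonObj (DualObj H Hd) :=
  dualComonObj H (DualObj H Hd) (HopfData.ofHopfObj H).cop rfl rfl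

theorem cop_comul_of_comm : (HopfData.ofHopfObj H).cop.comul = Δ[H] :=
  IsCommComonObj.comul_comm H

theorem inv_antipode_of_comm : inv 𝒮[H] = 𝒮[H] :=
  IsIso.inv_eq_of_hom_inv_id (antipode_antipode_of_comm H)

theorem dualCop_one_ev :
    H ◁ (dualCop H (DualObj H Hd)).one ≫ ε_ (DualObj H Hd) H = (ρ_ H).hom ≫ ε[H] :=
  HopfData.dual_one_ev _ (DualObj H Hd)

theorem dualCop_antipode_ev :
    H ◁ (dualCop H (DualObj H Hd)).antipode ≫ ε_ (DualObj H Hd) H =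
      𝒮[H] ▷ DualObj H Hd ≫ ε_ (DualObj H Hd) H := by
  refine (HopfData.dual_antipode_ev _ (DualObj H Hd)).trans ?_
  rw [← inv_antipode_of_comm]; rfl

theorem dualCop_mul_ev : H ◁ (dualCop H (DualObj H Hd)).mul ≫ ε_ (DualObj H Hd) H =
    Δ[H] ▷ (DualObj H Hd ⊗ DualObj H Hd) ≫ tensorμ H H (DualObj H Hd) (DualObj H Hd) ≫
      (ε_ (DualObj H Hd) H ⊗ₘ ε_ (DualObj H Hd) H) ≫ (λ_ (𝟙_ C)).hom := by
  refine (HopfData.dual_mul_ev _ (DualObj H Hd)).trans ?_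
  rw [cop_comul_of_comm]
  let x := fst H ((DualObj H Hd) ⊗ (DualObj H Hd))
  let u₁ := snd H ((DualObj H Hd) ⊗ (DualObj H Hd)) ≫ fst (DualObj H Hd) (DualObj H Hd)
  let u₂ := snd H ((DualObj H Hd) ⊗ (DualObj H Hd)) ≫ snd (DualObj H Hd) (DualObj H Hd)
  have hid : lift x (lift u₁ u₂) = 𝟙 _ := by
    rw [← comp_lift, lift_fst_snd, Category.comp_id, lift_fst_snd]
  have hΔ : x ≫ Δ[H] = lift x x := IsComonHom.hom_comul x
  have h₁ : Indep x u₁ := (indep_fst_snd _ _).comp_right _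
  -- The nested evaluation pairs `u₁` with the second copy of `x`; moving that scalar to the front
  -- interchanges the two copies.
  have h₀ : Indep x x := by simpa using (indep_of_comm (𝟙 H) (𝟙 H)).precomp x
  rw [← Category.id_comp (Δ[H] ▷ _ ≫ _), ← hid, lift_whiskerRight_assoc, hΔ, lift_assoc_assoc,
    lift_whiskerLeft_assoc, lift_assoc_inv_assoc, lift_whiskerRight_assoc,
    lift_lift_ev _ ((h₀.lift_right h₁).comp_right _), ← Category.id_comp (Δ[H] ▷ _ ≫ _), ← hid,
    lift_whiskerRight_assoc, hΔ, lift_tensorμ_assoc _ _ _ _ h₁, lift_map_assoc,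
    conv_unit_mul_def]

theorem dualCop_comul_ev :
    H ◁ (H ◁ Δ[DualObj H Hd] ≫ (α_ _ _ _).inv ≫ ε_ (DualObj H Hd) H ▷ DualObj H Hd ≫
      (λ_ (DualObj H Hd)).hom) ≫ ε_ (DualObj H Hd) H =
      (α_ H H (DualObj H Hd)).inv ≫ μ[H] ▷ (DualObj H Hd) ≫ ε_ (DualObj H Hd) H := by
  have h := HopfData.dual_comul_ev (HopfData.ofHopfObj H).cop (DualObj H Hd)
  have h' := HopfData.dualAct_ev (HopfData.ofHopfObj H).cop (DualObj H Hd)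
  rw [← h] at h'
  exact h'

section

variable {H Hd} {X : C} [ComonObj X]

omit [IsCommComonObj H] in
theorem whiskerLeft_eq_lift {Y : C} (f : X ⟶ Y) : H ◁ f = lift (fst H X) (snd H X ≫ f) := by
  rw [← lift_whiskerLeft, lift_fst_snd, Category.id_comp]

/-- Transposition turns the dual product into convolution, so by injectivity the monoid axioms of
the dual reduce to those of a convolution monoid. -/
theorem lift_dualCop_mul_ev (f g : X ⟶ DualObj H Hd) :
    H ◁ (lift f g ≫ (dualCop H (DualObj H Hd)).mul) ≫ ε_ (DualObj H Hd) H =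
      (H ◁ f ≫ ε_ (DualObj H Hd) H) * (H ◁ g ≫ ε_ (DualObj H Hd) H) := by
  have hΔ : fst H X ≫ Δ[H] = lift (fst H X) (fst H X) := IsComonHom.hom_comul _
  rw [whiskerLeft_comp, Category.assoc, dualCop_mul_ev, whiskerLeft_eq_lift, comp_lift,
    lift_whiskerRight_assoc, hΔ, lift_tensorμ_assoc _ _ _ _ ((indep_fst_snd H X).comp_right _),
    lift_map_assoc, conv_unit_mul_def, ← whiskerLeft_eq_lift, ← whiskerLeft_eq_lift]

theorem dualCop_one_ev_conv :
    H ◁ (ε[X] ≫ (dualCop H (DualObj H Hd)).one) ≫ ε_ (DualObj H Hd) H = 1 := by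
  rw [whiskerLeft_comp, Category.assoc, dualCop_one_ev, conv_one_def]
  have e : ε[H ⊗ X] = (ε[H] ⊗ₘ ε[X]) ≫ (λ_ _).hom := Comon.tensorObj_counit H X
  rw [e, ← rightUnitor_naturality, whisker_exchange_assoc]
  simp [MonoidalCategory.tensorHom_def, unitors_equal]

end

instance dualCopMonObj : MonObj (DualObj H Hd) where
  one := (dualCop H (DualObj H Hd)).one
  mul := (dualCop H (DualObj H Hd)).mul
  one_mul := by
    have h : lift (ε[DualObj H Hd] ≫ (dualCop H (DualObj H Hd)).one) (𝟙 _) ≫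
        (dualCop H (DualObj H Hd)).mul = 𝟙 _ := by
      refine ev_injective (X := H) ?_
      rw [lift_dualCop_mul_ev, dualCop_one_ev_conv, one_mul]
    rw [← lift_whiskerRight_assoc, lift_counit_left_assoc, Category.id_comp] at h
    exact ((Iso.inv_comp_eq _).1 h).trans (Category.comp_id _)
  mul_one := by
    have h : lift (𝟙 _) (ε[DualObj H Hd] ≫ (dualCop H (DualObj H Hd)).one) ≫
        (dualCop H (DualObj H Hd)).mul = 𝟙 _ := by
      refine ev_injective (X := H) ?_
      rw [lift_dualCop_mul_ev, dualCop_one_ev_conv, mul_one]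
    rw [← lift_whiskerLeft_assoc, lift_counit_right_assoc, Category.id_comp] at h
    exact ((Iso.inv_comp_eq _).1 h).trans (Category.comp_id _)
  mul_assoc := by
    let t₁ := fst (DualObj H Hd ⊗ DualObj H Hd) (DualObj H Hd) ≫
      fst (DualObj H Hd) (DualObj H Hd)
    let t₂ := fst (DualObj H Hd ⊗ DualObj H Hd) (DualObj H Hd) ≫
      snd (DualObj H Hd) (DualObj H Hd)
    let t₃ := snd ((DualObj H Hd) ⊗ (DualObj H Hd)) (DualObj H Hd)
    have hid : lift (lift t₁ t₂) t₃ = 𝟙 _ := by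
      rw [← comp_lift, lift_fst_snd, Category.comp_id, lift_fst_snd]
    rw [← Category.id_comp ((dualCop H (DualObj H Hd)).mul ▷ _ ≫ _),
      ← Category.id_comp ((α_ _ _ _).hom ≫ _),
      ← hid, lift_assoc_assoc, lift_whiskerLeft_assoc, lift_whiskerRight_assoc]
    refine ev_injective (X := H) ?_
    simp only [lift_dualCop_mul_ev, mul_assoc]

theorem isSkewPairing_ev : IsSkewPairing (ε_ (DualObj H Hd) H) where
  mul_left := by
    let y := fst (H ⊗ H) (DualObj H Hd) ≫ fst H H
    let x := fst (H ⊗ H) (DualObj H Hd) ≫ snd H H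
    let u := snd (H ⊗ H) (DualObj H Hd)
    have hid : lift (lift y x) u = 𝟙 _ := by
      rw [← comp_lift, lift_fst_snd, Category.comp_id, lift_fst_snd]
    have hΔ : u ≫ Δ[DualObj H Hd] = lift u u := IsComonHom.hom_comul u
    have hyx : Indep y x := (indep_fst_snd _ _).precomp _
    have hyu : Indep y u := (indep_fst_snd _ _).comp_left _
    have e := dualCop_comul_ev H Hd
    rw [Iso.eq_inv_comp] at e
    have hyx' : lift y x ≫ (β_ H H).hom = lift x y := hyx
    rw [← e, ← Category.id_comp ((α_ _ _ _).hom ≫ _), ← hid, lift_assoc_assoc,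
      lift_whiskerLeft_assoc, lift_whiskerLeft_assoc, hΔ, lift_assoc_inv_assoc,
      lift_whiskerRight_assoc, lift_lift_ev _ ((hyx.lift_right hyu).comp_right _),
      ← Category.id_comp ((_ ⊗ₘ _) ≫ _), ← hid, lift_map_assoc, hyx', hΔ,
      lift_tensorμ_assoc _ _ _ _ hyu, lift_map_assoc, conv_unit_mul_def]
  mul_right := dualCop_mul_ev H Hd
  one_left := by
    change _ = (λ_ _).hom ≫ (λ_ _).inv ≫ η[H] ▷ _ ≫ ε_ (DualObj H Hd) H
    rw [Iso.hom_inv_id_assoc]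
  one_right := dualCop_one_ev H Hd

theorem lift_one_ev {X : C} [ComonObj X] (f : X ⟶ DualObj H Hd) :
    lift 1 f ≫ ε_ (DualObj H Hd) H = f ≫ ε[DualObj H Hd] := by
  rw [conv_one_def, ← lift_whiskerRight_assoc, lift_counit_left_assoc,
    (isSkewPairing_ev H Hd).one_left, Iso.inv_hom_id_assoc]

omit [SymmetricCategory C] [HopfObj H] [IsCommComonObj H] in
/-- Two morphisms to the tensor square of the dual are equal if they pair equally with
`y ⊗ x`. -/
theorem ev_ev_injective {X : C} {f g : X ⟶ DualObj H Hd ⊗ DualObj H Hd}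
    (h : H ◁ (H ◁ f ≫ (α_ _ _ _).inv ≫ ε_ (DualObj H Hd) H ▷ _ ≫ (λ_ _).hom) ≫
      ε_ (DualObj H Hd) H =
      H ◁ (H ◁ g ≫ (α_ _ _ _).inv ≫ ε_ (DualObj H Hd) H ▷ _ ≫ (λ_ _).hom) ≫
      ε_ (DualObj H Hd) H) : f = g :=
  lift_ev_injective (X := H) (ev_injective (X := H) h)

section

variable {H Hd} {X : C} [ComonObj X]

omit [IsCommComonObj H] in
theorem lift_ev_ev (f g : X ⟶ DualObj H Hd) :
    H ◁ (H ◁ lift f g ≫ (α_ _ _ _).inv ≫ ε_ (DualObj H Hd) H ▷ _ ≫ (λ_ _).hom) ≫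
      ε_ (DualObj H Hd) H =
    (lift (snd H (H ⊗ X) ≫ fst H X) (snd H (H ⊗ X) ≫ snd H X ≫ f) ≫ ε_ (DualObj H Hd) H) *
    (lift (fst H (H ⊗ X)) (snd H (H ⊗ X) ≫ snd H X ≫ g) ≫ ε_ (DualObj H Hd) H) := by
  have h : Indep (fst H (H ⊗ X)) (snd H (H ⊗ X)) := indep_fst_snd _ _
  rw [whiskerLeft_eq_lift (lift f g), comp_lift, lift_assoc_inv_assoc, lift_whiskerRight_assoc,
    whiskerLeft_eq_lift, comp_lift_assoc, comp_lift_assoc,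
    lift_lift_ev _ ((h.comp_right _).lift_right (h.comp_right _) |>.comp_right _)]

theorem comp_comul_ev_ev (f : X ⟶ DualObj H Hd) :
    H ◁ (H ◁ (f ≫ Δ[DualObj H Hd]) ≫ (α_ _ _ _).inv ≫ ε_ (DualObj H Hd) H ▷ _ ≫ (λ_ _).hom) ≫
      ε_ (DualObj H Hd) H =
    lift (fst H (H ⊗ X) * (snd H (H ⊗ X) ≫ fst H X)) (snd H (H ⊗ X) ≫ snd H X ≫ f) ≫
      ε_ (DualObj H Hd) H := by
  have e := dualCop_comul_ev H Hd
  rw [whiskerLeft_comp H f, Category.assoc, whiskerLeft_comp H (H ◁ f), Category.assoc, e,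
    whiskerLeft_eq_lift f, whiskerLeft_eq_lift, comp_lift, lift_assoc_inv_assoc,
    lift_whiskerRight_assoc]
  rfl

end

theorem dualCop_one_counit : η[DualObj H Hd] ≫ ε[DualObj H Hd] = 𝟙 _ := by
  have h : H ◁ η[DualObj H Hd] ≫ ε_ (DualObj H Hd) H = (ρ_ H).hom ≫ ε[H] := dualCop_one_ev H Hd
  have h' := (isSkewPairing_ev H Hd).one_left
  rw [← Iso.inv_comp_eq] at h'
  rw [← h', leftUnitor_inv_naturality_assoc, whisker_exchange_assoc, h]
  simp [unitors_inv_equal]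

theorem lift_mul_ev {X : C} [ComonObj X] {y x : X ⟶ H} {u : X ⟶ DualObj H Hd} [IsComonHom u]
    (h : Indep y x) (h' : Indep y u) : lift (y * x) u ≫ ε_ (DualObj H Hd) H =
      (lift x u ≫ ε_ (DualObj H Hd) H) * (lift y u ≫ ε_ (DualObj H Hd) H) :=
  (isSkewPairing_ev H Hd).lift_mul_left h h'

/-- Paired with `y ⊗ x`, both sides become products of the four pairings of `x, y` with `u, u'`.
They differ by the order of the two middle factors, which commute because they involve disjoint
independent variables. -/
theorem dualCop_mul_comul :
    lift (fst (DualObj H Hd) (DualObj H Hd)) (snd (DualObj H Hd) (DualObj H Hd)) ≫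
      μ[DualObj H Hd] ≫ Δ[DualObj H Hd] = lift μ[DualObj H Hd] μ[DualObj H Hd] := by
  have hb := isSkewPairing_ev H Hd
  let y := fst H (H ⊗ (DualObj H Hd ⊗ DualObj H Hd))
  let x := snd H (H ⊗ (DualObj H Hd ⊗ DualObj H Hd)) ≫ fst H (DualObj H Hd ⊗ DualObj H Hd)
  let u := (snd H (H ⊗ (DualObj H Hd ⊗ DualObj H Hd)) ≫
    snd H (DualObj H Hd ⊗ DualObj H Hd)) ≫ fst (DualObj H Hd) (DualObj H Hd)
  let u' := (snd H (H ⊗ (DualObj H Hd ⊗ DualObj H Hd)) ≫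
    snd H (DualObj H Hd ⊗ DualObj H Hd)) ≫ snd (DualObj H Hd) (DualObj H Hd)
  have hyx : Indep y x := (indep_fst_snd _ _).comp_right _
  have hyu : Indep y u := ((indep_fst_snd _ _).comp_right _).comp_right _
  have hyu' : Indep y u' := ((indep_fst_snd _ _).comp_right _).comp_right _
  have hxu : Indep x u := ((indep_fst_snd _ _).precomp _).comp_right _
  have hxu' : Indep x u' := ((indep_fst_snd _ _).precomp _).comp_right _
  have huu' : Indep u u' := (indep_fst_snd _ _).precomp _
  have hm : fst (DualObj H Hd) (DualObj H Hd) * snd (DualObj H Hd) (DualObj H Hd) =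
      μ[DualObj H Hd] := by
    rw [conv_mul_def, lift_fst_snd, Category.id_comp]
  have he : snd H (H ⊗ (DualObj H Hd ⊗ DualObj H Hd)) ≫
      snd H (DualObj H Hd ⊗ DualObj H Hd) ≫ μ[DualObj H Hd] = u * u' := by
    rw [← hm, ← Category.assoc, comp_conv_mul]
  have := hyx.isComonHom_mul
  have hc : Commute (lift x u' ≫ ε_ (DualObj H Hd) H) (lift y u ≫ ε_ (DualObj H Hd) H) :=
    ((((hyx.symm.lift_right hxu).lift_left (hyu'.symm.lift_right huu'.symm)).comp _ _)).commute_unit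
  rw [lift_fst_snd, Category.id_comp]
  refine ev_ev_injective H Hd ?_
  rw [lift_ev_ev, comp_comul_ev_ev, he, hb.lift_mul_right (Indep.mul_left hyu hxu),
    lift_mul_ev H Hd hyx hyu, lift_mul_ev H Hd hyx hyu', hb.lift_mul_right hxu,
    hb.lift_mul_right hyu, mul_assoc, mul_assoc, ← mul_assoc _ _ (lift y u' ≫ _), ← hc.eq,
    mul_assoc]

instance dualCopBimonObj : BimonObj (DualObj H Hd) where
  toMonObj := inferInstance
  toComonObj := inferInstance
  one_counit := dualCop_one_counit H Hd
  mul_counit := by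
    have hb := isSkewPairing_ev H Hd
    -- The counit of the dual is evaluation at the unit of `H`, so its multiplicativity is that of
    -- the pairing at `1`.
    rw [← lift_one_ev]
    have h := hb.lift_mul_right (X := DualObj H Hd ⊗ DualObj H Hd) (v := 1)
      (u := fst (DualObj H Hd) (DualObj H Hd)) (u' := snd (DualObj H Hd) (DualObj H Hd))
      (indep_one_left _)
    have hm : fst (DualObj H Hd) (DualObj H Hd) * snd _ _ = μ[DualObj H Hd] := by
      rw [conv_mul_def, lift_fst_snd, Category.id_comp]
    rw [hm, hb.lift_one_left (fst _ _) (IsComonHom.hom_counit _),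
      hb.lift_one_left (snd _ _) (IsComonHom.hom_counit _), one_mul] at h
    rw [h]
    exact Category.comp_id _
  one_comul := by
    have hb := isSkewPairing_ev H Hd
    have h : (1 : DualObj H Hd ⟶ DualObj H Hd) ≫ Δ[DualObj H Hd] = lift 1 1 := by
      refine ev_ev_injective H Hd ?_
      rw [lift_ev_ev, comp_comul_ev_ev, comp_conv_one, comp_conv_one]
      have := Indep.isComonHom_mul (indep_fst_snd H (H ⊗ DualObj H Hd) |>.comp_right (fst _ _))
      rw [hb.lift_one_right _ (by simp), hb.lift_one_right _ (by simp),
        hb.lift_one_right _ (by simp), one_mul]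
    rw [lift_one_one] at h
    have h' := congrArg (η[DualObj H Hd] ≫ ·) h
    have e := dualCop_one_counit H Hd
    simpa only [conv_one_def, Category.assoc, reassoc_of% e] using h'
  mul_comul := by
    have h := dualCop_mul_comul H Hd
    have e : Δ[DualObj H Hd ⊗ DualObj H Hd] = (Δ[DualObj H Hd] ⊗ₘ Δ[DualObj H Hd]) ≫
      tensorμ _ _ _ _ := Comon.tensorObj_comul _ _
    rw [lift_fst_snd, Category.id_comp] at h
    rw [h, lift, e, Category.assoc]

theorem lift_ev_antipode {X : C} [ComonObj X] (v : X ⟶ H) (u : X ⟶ DualObj H Hd) :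
    lift v (u ≫ (dualCop H (DualObj H Hd)).antipode) ≫ ε_ (DualObj H Hd) H =
      lift (v ≫ 𝒮[H]) u ≫ ε_ (DualObj H Hd) H := by
  rw [← lift_whiskerLeft, Category.assoc, dualCop_antipode_ev, lift_whiskerRight_assoc]

/-- The Hopf algebra `(H^cop)^*`. -/
instance dualCopHopfObj : HopfObj (DualObj H Hd) where
  antipode := (dualCop H (DualObj H Hd)).antipode
  antipode_left := by
    have h : (dualCop H (DualObj H Hd)).antipode * 𝟙 (DualObj H Hd) = 1 := by
      refine ev_injective (X := H) ?_
      refine (lift_dualCop_mul_ev _ _).trans (Eq.trans ?_ (dualCop_one_ev_conv).symm)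
      have h' := (isSkewPairing_ev H Hd).lift_antipode_mul (indep_fst_snd H (DualObj H Hd))
      rw [← lift_ev_antipode] at h'
      rwa [whiskerLeft_eq_lift, whiskerLeft_eq_lift, Category.comp_id]
    rw [conv_mul_def, lift, tensorHom_id, Category.assoc] at h
    exact h
  antipode_right := by
    have h : 𝟙 (DualObj H Hd) * (dualCop H (DualObj H Hd)).antipode = 1 := by
      refine ev_injective (X := H) ?_
      refine (lift_dualCop_mul_ev _ _).trans (Eq.trans ?_ (dualCop_one_ev_conv).symm)
      have h' := (isSkewPairing_ev H Hd).mul_lift_antipode (indep_fst_snd H (DualObj H Hd))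
      rw [← lift_ev_antipode] at h'
      rwa [whiskerLeft_eq_lift, whiskerLeft_eq_lift, Category.comp_id]
    rw [conv_mul_def, lift, id_tensorHom, Category.assoc] at h
    exact h

end DualHopf

/-! ### Identification with the Drinfeld double. -/

section Double

variable {C : Type u} [Category.{v} C] [MonoidalCategory C]

/-- Rewrites the iterated-coproduct formulas of `HopfData.deform`, for product and antipode alike,
as convolution products. -/
theorem comul_comul_scal {X A : C} [ComonObj X] [MonObj A] (a c : X ⟶ 𝟙_ C) (f : X ⟶ A) :
    Δ[X] ≫ X ◁ Δ[X] ≫ (a ⊗ₘ (f ⊗ₘ c)) ≫ (λ_ (A ⊗ 𝟙_ C)).hom ≫ (ρ_ A).hom =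
      scal A a * f * scal A c := by
  have h : Δ[X] ≫ X ◁ Δ[X] ≫ (a ⊗ₘ (f ⊗ₘ c)) = lift a (lift f c) := by
    rw [← id_tensorHom, tensorHom_comp_tensorHom, Category.id_comp]; rfl
  rw [reassoc_of% h, mul_assoc, scal_mul_eq_lift, mul_scal_eq_lift, ← lift_whiskerLeft,
    Category.assoc]
  congr 1
  monoidal

variable [SymmetricCategory C] (H Hd : C) [HopfObj H] [IsCommComonObj H] [ExactPairing Hd H]

theorem tensorDouble_eq : HopfData.ofHopfObj (DualObj H Hd ⊗ H) =
    tensorDouble H (DualObj H Hd) := by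
  refine HopfData.ext rfl rfl rfl ?_ rfl
  exact Comon.tensorObj_comul _ _

theorem tensorComul_tensorDouble :
    HopfData.tensorComul (tensorDouble H (DualObj H Hd)) (tensorDouble H (DualObj H Hd)) =
      Δ[(DualObj H Hd ⊗ H) ⊗ (DualObj H Hd ⊗ H)] := by
  rw [← tensorDouble_eq]
  exact (Comon.tensorObj_comul _ _).symm

theorem doubleProj_eq : doubleProj H (DualObj H Hd) =
    lift (fst _ _ ≫ snd (DualObj H Hd) H) (snd _ _ ≫ fst (DualObj H Hd) H) := by
  rw [← lift_map, lift_fst_snd, Category.id_comp]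
  rfl

theorem doubleCocycle_eq : doubleCocycle H (DualObj H Hd) =
    cocyc (ε_ (DualObj H Hd) H) (fst _ _) (snd _ _) := by
  rw [doubleCocycle, doubleProj_eq, cocyc]

theorem doubleCocycleInv_eq : doubleCocycleInv H (DualObj H Hd) =
    cocycInv (ε_ (DualObj H Hd) H) (fst _ _) (snd _ _) := by
  rw [doubleCocycleInv, doubleProj_eq, cocycInv, inv_antipode_of_comm, lift_whiskerRight_assoc,
    Category.assoc]

theorem lift_doubleCocycle :
    lift (𝟙 _) 𝒮[DualObj H Hd ⊗ H] ≫ doubleCocycle H (DualObj H Hd) =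
      lift (snd (DualObj H Hd) H) (fst (DualObj H Hd) H ≫ 𝒮[DualObj H Hd]) ≫
        ε_ (DualObj H Hd) H := by
  have e : 𝒮[DualObj H Hd ⊗ H] ≫ fst (DualObj H Hd) H =
      fst (DualObj H Hd) H ≫ 𝒮[DualObj H Hd] := by
    rw [antipode_tensor, fst, MonoidalCategory.tensorHom_def, Category.assoc, Category.assoc,
      ← MonoidalCategory.whiskerLeft_comp_assoc, HopfObj.antipode_counit,
      ← whisker_exchange_assoc, rightUnitor_naturality]
  have h : doubleProj H (DualObj H Hd) = (snd (DualObj H Hd) H ⊗ₘ fst (DualObj H Hd) H) := rfl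
  rw [doubleCocycle, h, lift_map_assoc, Category.id_comp, e]

/-- The antipode in `f'` cancels the inverse antipode in `ω⁻¹`, leaving the bare evaluation. -/
theorem lift_doubleCocycleInv :
    lift 𝒮[DualObj H Hd ⊗ H] (𝟙 _) ≫ doubleCocycleInv H (DualObj H Hd) =
      lift (snd (DualObj H Hd) H) (fst (DualObj H Hd) H) ≫ ε_ (DualObj H Hd) H := by
  have e : 𝒮[DualObj H Hd ⊗ H] ≫ snd (DualObj H Hd) H =
      snd (DualObj H Hd) H ≫ 𝒮[H] := by
    rw [antipode_tensor, snd, MonoidalCategory.tensorHom_def', Category.assoc, Category.assoc,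
      ← comp_whiskerRight_assoc, HopfObj.antipode_counit, whisker_exchange_assoc,
      leftUnitor_naturality]
  have h : doubleProj H (DualObj H Hd) = (snd (DualObj H Hd) H ⊗ₘ fst (DualObj H Hd) H) := rfl
  rw [doubleCocycleInv, inv_antipode_of_comm, h, lift_map_assoc, Category.id_comp, e,
    lift_whiskerRight_assoc, Category.assoc, antipode_antipode_of_comm, Category.comp_id]

theorem drinfeldDouble_eq : HopfData.ofHopfObj (Dbl (isSkewPairing_ev H Hd)) =
    drinfeldDouble H (DualObj H Hd) := by
  refine HopfData.ext rfl ?_ rfl (Comon.tensorObj_comul _ _) ?_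
  · change twistMul _ = _
    have h := comul_comul_scal (doubleCocycle H (DualObj H Hd))
      (doubleCocycleInv H (DualObj H Hd)) μ[DualObj H Hd ⊗ H]
    rw [doubleCocycle_eq, doubleCocycleInv_eq, ← tensorComul_tensorDouble] at h
    rw [drinfeldDouble, doubleCocycle_eq, doubleCocycleInv_eq]
    exact h.symm
  · change twistAntipode _ = _
    have h := comul_comul_scal (lift (𝟙 _) 𝒮[DualObj H Hd ⊗ H] ≫ doubleCocycle H (DualObj H Hd))
      (lift 𝒮[DualObj H Hd ⊗ H] (𝟙 _) ≫ doubleCocycleInv H (DualObj H Hd)) 𝒮[DualObj H Hd ⊗ H]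
    have e : scal (DualObj H Hd ⊗ H) (lift (𝟙 _) 𝒮[DualObj H Hd ⊗ H] ≫
          doubleCocycle H (DualObj H Hd)) * 𝒮[DualObj H Hd ⊗ H] *
        scal _ (lift 𝒮[DualObj H Hd ⊗ H] (𝟙 _) ≫ doubleCocycleInv H (DualObj H Hd)) =
        twistAntipode (ε_ (DualObj H Hd) H) := by
      rw [lift_doubleCocycle, lift_doubleCocycleInv, twistAntipode]
    rw [e, lift, lift, id_tensorHom, tensorHom_id, Category.assoc, Category.assoc,
      Comon.tensorObj_comul] at h
    exact h.symm

theorem isHopfBrace_dualObj :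
    IsHopfBrace (tensorDouble H (DualObj H Hd)) (drinfeldDouble H (DualObj H Hd)) where
  isHopf₁ := ⟨_, tensorDouble_eq H Hd⟩
  isHopf₂ := ⟨hopfObjDbl (isSkewPairing_ev H Hd), drinfeldDouble_eq H Hd⟩
  counit_eq := rfl
  comul_eq := rfl
  compat := by
    rw [← tensorDouble_eq, ← drinfeldDouble_eq]
    exact twistMul_compat (isSkewPairing_ev H Hd)

end Double

end

end HopfBraces

theorem theorem2p10 {C : Type u} [Category.{v} C] [MonoidalCategory C] [SymmetricCategory C]
    (H Hd : C) [HopfObj H] [IsCommComonObj H] [ExactPairing Hd H] :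
    HopfBraces.IsHopfBrace (HopfBraces.tensorDouble H Hd) (HopfBraces.drinfeldDouble H Hd) :=
  HopfBraces.isHopfBrace_dualObj H Hd
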